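/- **Setting.** Let $(\mathcal X,\Sigma)$ be a measurable space in which all singletons are measurable, and $\mathcal H$ a class of measurable functions $h:\mathcal X\to\{0,1\}$ with finite VC dimension $d_{\mathcal H}$ (the largest number of points on which all $0$-$1$ labellings are realized by elements of $\mathcal H$). Let $0<\alpha<\tfrac12$. For probability measures $\mu_0,\mu_1$ on $(\mathcal X,\Sigma)$ put $R_{\mu_0}(h)=\mu_0(h=1)$, $R_{\mu_1}(h)=\mu_1(h=0)$, $\mathcal H_\alpha(\mu_0)=\{h\in\mathcal H: R_{\mu_0}(h)\le\alpha\}$ and $$\mathcal E_\alpha(h)=\max\Big\{0,\;R_{\mu_1}(h)-\inf_{h'\in\mathcal H_\alpha(\mu_0)}R_{\mu_1}(h')\Big\}.$$ Let $\mathcal U$ be the set of pairs $(\mu_0,\mu_1)$ with $\mathcal H_\alpha(\mu_0)\neq\emptyset$, and $\mathcal U(\mu_0)=\{\mu_1:(\mu_0,\mu_1)\in\mathcal U\}$. An exact $\alpha$-learner (for known $\mu_0$) is a map $\hat h:\mathcal X^n\to\mathcal H_\alpha(\mu_0)$. The minimax risk is $$\mathcal M_n(\mu_0)=\inf_{\hat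 h}\ \sup_{\mu_1\in\mathcal U(\mu_0)}\ \mathbb E_{S\sim\mu_1^n}\,\mathcal E_\alpha(\hat h(S)),$$ where the infimum is over all exact $\alpha$-learners, and $\mathbb E$ is the upper expectation (the least integral of a measurable majorant), i.e. the ordinary expectation when the integrand is measurable. $\mathcal H$ *separates three points* if there are $h_1,h_2\in\mathcal H$ and $x_0,x_1,x_2\in\mathcal X$ with $h_1(x_0)=h_2(x_0)=0$, $h_1(x_1)=h_2(x_2)=1$ and $h_1(x_2)=h_2(x_1)=0$. A subset $\mathcal F\subset\mathcal H$ *admits a maximal element* if some $h\in\mathcal F$ satisfies $\{h=1\}\supset\{h'=1\}$ for all $h'\in\mathcal F$. The class $\mathcal H$ is *empirically measurable* if for all $m$, all $b\in\{0,1\}^m$ and all probability measures $\mu$ on $\mathcal X$, the set $\{(x_1,\dots,x_m):\exists h\in\mathcal H,\ h(x_i)=b_i\ \forall i\}$ is measurable for the completion of $\mu^m$ (the usual measurability proviso for uniform convergence over a VC class). **Theorem.** There are universal constants $c,C>0$ such that, for all $(\mathcal X,\Sigma)$, $\mathcal H$ and $\alpha$ as above, the following holds. (i) If $\mathcal H$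 separates three points, then there is $\mu_0$ with $\mathcal H_\alpha(\mu_0)\ne\emptyset$ such that for all $n\ge 2d_{\mathcal H}$ $$c\sqrt{\frac{d_{\mathcal H}}{n}}\ \le\ \mathcal M_n(\mu_0),$$ and, if $\mathcal H$ is empirically measurable, also $$\mathcal M_n(\mu_0)\ \le\ C\sqrt{\frac{d_{\mathcal H}}{n}\log n}.$$ (ii) If $\mathcal H$ does not separate three points, then for every $\mu_0$ with $\mathcal H_\alpha(\mu_0)\neq\emptyset$ and every $n\ge 2d_{\mathcal H}$: (a) if $\mathcal H_\alpha(\mu_0)$ does not admit a maximal element, then $$c\,\frac{d_{\mathcal H}}{n}\ \le\ \mathcal M_n(\mu_0),$$ and, if $\mathcal H$ is empirically measurable, also $$\mathcal M_n(\mu_0)\ \le\ C\,\frac{d_{\mathcal H}}{n}\log n;$$ (b) if $\mathcal H_\alpha(\mu_0)$ admits a maximal element, then $\mathcal M_n(\mu_0)=0$. -/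

import Mathlib

open MeasureTheory
open scoped ENNReal

universe u

noncomputable section

namespace NeymanPearson

variable {X : Type u}

/-- `H` shatters the finite set `s`: every `0`-`1` labelling of `s` is realized by some `h ∈ H`. -/
def Shatters (H : Set (X → Bool)) (s : Finset X) : Prop :=
  ∀ b : X → Bool, ∃ h ∈ H, ∀ x ∈ s, h x = b x

/-- `H` has finite VC dimension, equal to `d`: the largest number of points shattered by `H`
is `d`. -/
def HasVCDim (H : Set (X → Bool)) (d : ℕ) : Prop :=
  IsGreatest {k : ℕ | ∃ s : Finset X, s.card = k ∧ Shatters H s} d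

/-- `H` separates three points. -/
def SeparatesThreePoints (H : Set (X → Bool)) : Prop :=
  ∃ h₁ ∈ H, ∃ h₂ ∈ H, ∃ x₀ x₁ x₂ : X,
    (h₁ x₀ = false ∧ h₂ x₀ = false) ∧
    (h₁ x₁ = true ∧ h₂ x₂ = true ∧ h₁ x₂ = false ∧ h₂ x₁ = false)

/-- `F` admits a maximal element: some `h ∈ F` has `{h = 1} ⊇ {h' = 1}` for all `h' ∈ F`. -/
def AdmitsMaximal (F : Set (X → Bool)) : Prop :=
  ∃ h ∈ F, ∀ h' ∈ F, {x | h' x = true} ⊆ {x | h x = true}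

variable [MeasurableSpace X]

/-- The `μ₀`-risk `R_{μ₀}(h) = μ₀(h = 1)`. -/
def risk₀ (μ₀ : ProbabilityMeasure X) (h : X → Bool) : ℝ :=
  (μ₀ : Measure X).real {x | h x = true}

/-- The `μ₁`-risk `R_{μ₁}(h) = μ₁(h = 0)`. -/
def risk₁ (μ₁ : ProbabilityMeasure X) (h : X → Bool) : ℝ :=
  (μ₁ : Measure X).real {x | h x = false}

/-- The class `H_α(μ₀)` of hypotheses in `H` with `μ₀`-risk at most `α`. -/
def level (H : Set (X → Bool)) (α : ℝ) (μ₀ : ProbabilityMeasure X) : Set (X → Bool) :=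
  {h | h ∈ H ∧ risk₀ μ₀ h ≤ α}

/-- The `μ₁`-excess-risk at level `α`. The infimum is over a set of reals in `[0, 1]`; it is only
used when `H_α(μ₀)` is non-empty. -/
def excessRisk (H : Set (X → Bool)) (α : ℝ) (μ₀ μ₁ : ProbabilityMeasure X) (h : X → Bool) : ℝ :=
  max 0 (risk₁ μ₁ h - sInf (risk₁ μ₁ '' level H α μ₀))

/-- The family `𝒰` of all pairs `(μ₀, μ₁)` such that `H_α(μ₀)` is non-empty. -/
def pairs (H : Set (X → Bool)) (α : ℝ) : Set (ProbabilityMeasure X × ProbabilityMeasure X) :=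
  {p | (level H α p.1).Nonempty}

/-- The projection `𝒰(μ₀)`: all `μ₁` with `(μ₀, μ₁) ∈ 𝒰`. -/
def pairsAt (H : Set (X → Bool)) (α : ℝ) (μ₀ : ProbabilityMeasure X) :
    Set (ProbabilityMeasure X) :=
  {μ₁ | (μ₀, μ₁) ∈ pairs H α}

/-- The law of an i.i.d. sample of size `n`. -/
def iidLaw (μ : ProbabilityMeasure X) (n : ℕ) : Measure (Fin n → X) :=
  Measure.pi fun _ => (μ : Measure X)

/-- Upper expectation of a `[0, ∞]`-valued function: the least integral of a measurable majorant.
It is the ordinary expectation whenever `f` is measurable. -/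
def upperExp {Ω : Type u} [MeasurableSpace Ω] (P : Measure Ω) (f : Ω → ℝ≥0∞) : ℝ≥0∞ :=
  ⨅ (g : Ω → ℝ≥0∞) (_ : Measurable g) (_ : ∀ ω, f ω ≤ g ω), ∫⁻ ω, g ω ∂P

/-- An exact `α`-learner, for known `μ₀`: a map from samples of size `n` to `H_α(μ₀)`. -/
abbrev ExactLearner (H : Set (X → Bool)) (α : ℝ) (μ₀ : ProbabilityMeasure X) (n : ℕ) : Type u :=
  (Fin n → X) → level H α μ₀

/-- The minimax risk `inf_ĥ sup_{𝒰(μ₀)} E_{S ∼ μ₁ⁿ} ℰ_α(ĥ)` over exact `α`-learners. -/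
def minimaxRisk (H : Set (X → Bool)) (α : ℝ) (μ₀ : ProbabilityMeasure X) (n : ℕ) : ℝ≥0∞ :=
  ⨅ A : ExactLearner H α μ₀ n, ⨆ μ₁ ∈ pairsAt H α μ₀,
    upperExp (iidLaw μ₁ n) fun S => ENNReal.ofReal (excessRisk H α μ₀ μ₁ (A S))

/-- The measurability requirement on `H` as a class: for every finite pattern `b`, the set of
`m`-tuples of points on which some `h ∈ H` takes the values `b` is measurable with respect to the
completion of every product measure `μᵐ`. -/
def EmpiricallyMeasurable (H : Set (X → Bool)) : Prop :=
  ∀ (m : ℕ) (b : Fin m → Bool) (μ : ProbabilityMeasure X),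
    NullMeasurableSet {x : Fin m → X | ∃ h ∈ H, ∀ i, h (x i) = b i} (iidLaw μ m)

end NeymanPearson

end

/-! ### Hellinger affinity and Assouad's lemma on finite alphabets -/

namespace NeymanPearson

/-! Since α < 1/2, two members of H_α(μ₀) cannot cover the space. If they are incomparable, a point
outside both completes a three-point separation (`level_nested`). Hence without separation H_α(μ₀)
is a chain, and moreover d ≤ 2. A maximal element of the chain is optimal against every μ₁, so the
risk is 0. If there is none, whatever the learner answers on a constant sample misses a point x₁ of
some larger hypothesis; mass 1/(2n) at x₁ stays unseen with probability at least 1/2 and costs order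
1/n.

With separation, there are m pairs of points, m comparable to d, from which H can select arbitrary
representatives while avoiding a base point (`PairSystem`). Let μ₀ weight these points so that the
level α allows at most m of the 2m pair points. Adding a point then forces another to be given up,
and a learner must guess m hidden bits from slightly tilted uniform distributions. Assouad's lemma
(`exists_pairWeight_risk_ge`) gives √(d/n).

Both upper bounds come from empirical risk minimization over H_α(μ₀), analysed by symmetrization,
the Sauer-Shelah bound and exponential moments (`EmpiricallyMeasurable.exists_deviation_bound`). In
general the mean is compared with the empirical mean, which gives the square root. On a chain the
minimizer misses no sample point that its competitor selects, so the relevant empirical mean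
vanishes; comparing the mean with twice the empirical mean then has bounded exponential moments at
constant scale and gives the fast rate. -/

/-- The affinity ∑ √(pq) is multiplicative over products, so by Bernoulli's inequality the n-fold
affinity is at least 15/16; this keeps the L¹ distance away from 2. -/
theorem sum_abs_prod_sub_prod_le {κ : Type*} [Fintype κ] {p q : κ → ℝ} (hp : ∀ k, 0 ≤ p k)
    (hq : ∀ k, 0 ≤ q k) (hp1 : ∑ k, p k = 1) (hq1 : ∑ k, q k = 1) {n : ℕ} (hn : 0 < n)
    (h : 1 - 1 / (16 * n : ℝ) ≤ ∑ k, √(p k * q k)) :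
    ∑ s : Fin n → κ, |∏ i, p (s i) - ∏ i, q (s i)| ≤ 3 / 4 := by
  have hn' : (0 : ℝ) < n := by exact_mod_cast hn
  have hn1 : (1 : ℝ) ≤ n := by exact_mod_cast hn
  set P : (Fin n → κ) → ℝ := fun s => ∏ i, p (s i)
  set Q : (Fin n → κ) → ℝ := fun s => ∏ i, q (s i)
  have hP : ∀ s, 0 ≤ P s := fun s => Finset.prod_nonneg fun i _ => hp _
  have hQ : ∀ s, 0 ≤ Q s := fun s => Finset.prod_nonneg fun i _ => hq _
  have hP1 : ∑ s, P s = 1 := by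
    rw [← Fintype.sum_pow p n, hp1, one_pow]
  have hQ1 : ∑ s, Q s = 1 := by
    rw [← Fintype.sum_pow q n, hq1, one_pow]
  have hBC : 15 / 16 ≤ ∑ s, √(P s) * √(Q s) := by
    have h1 : ∀ s, √(P s) * √(Q s) = ∏ i, √(p (s i) * q (s i)) := by
      intro s
      rw [← Real.sqrt_mul (hP s), ← Finset.prod_mul_distrib,
        Real.sqrt_prod _ fun i _ => mul_nonneg (hp _) (hq _)]
    simp_rw [h1]
    rw [← Fintype.sum_pow (fun k => √(p k * q k)) n]
    have hx : (1 : ℝ) / (16 * n) ≤ 1 := by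
      rw [div_le_one (by positivity)]; linarith
    calc (15 / 16 : ℝ) = 1 + n * (-(1 / (16 * n))) := by field_simp; norm_num
      _ ≤ (1 + -(1 / (16 * n))) ^ n := one_add_mul_le_pow (by linarith) n
      _ ≤ _ := by
        apply pow_le_pow_left₀ (by linarith)
        linarith
  -- With a = √P and b = √Q this is |a - b|(a + b) ≤ 2(a - b)² + (a + b)²/8. The weights are tuned
  -- so that 17/4 - (15/4)(15/16) ≤ 3/4.
  have key : ∀ s, |P s - Q s| ≤ (17 / 8) * (P s + Q s) - (15 / 4) * (√(P s) * √(Q s)) := by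
    intro s
    have e1 := Real.sq_sqrt (hP s)
    have e2 := Real.sq_sqrt (hQ s)
    set a := √(P s)
    set b := √(Q s)
    rw [← e1, ← e2, abs_le]
    constructor
    · nlinarith [sq_nonneg (5 * a - 3 * b), sq_nonneg (3 * a - 5 * b)]
    · nlinarith [sq_nonneg (5 * a - 3 * b), sq_nonneg (3 * a - 5 * b)]
  calc ∑ s, |P s - Q s| ≤ ∑ s, ((17 / 8) * (P s + Q s) - (15 / 4) * (√(P s) * √(Q s))) :=
        Finset.sum_le_sum fun s _ => key s
    _ = (17 / 8) * (∑ s, P s + ∑ s, Q s) - (15 / 4) * ∑ s, √(P s) * √(Q s) := by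
        rw [Finset.sum_sub_distrib, ← Finset.mul_sum, ← Finset.mul_sum, Finset.sum_add_distrib]
    _ ≤ 3 / 4 := by rw [hP1, hQ1]; linarith

/-- The sign `1` if the two bits agree and `-1` otherwise. -/
noncomputable def bitSign (a b : Bool) : ℝ := if a = b then 1 else -1

theorem bitSign_true (a : Bool) : bitSign a true = -bitSign a false := by
  cases a <;> simp [bitSign]

theorem abs_bitSign (a b : Bool) : |bitSign a b| = 1 := by
  unfold bitSign; split_ifs <;> simp

/-- Perturbation, in the direction `σ`, of the uniform distribution on `m` pairs. -/
noncomputable def pairWeight {m : ℕ} (ε : ℝ) (σ : Fin m → Bool) (k : Fin m × Bool) : ℝ :=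
  (1 + ε * bitSign (σ k.1) k.2) / (2 * m)

theorem pairWeight_nonneg {m : ℕ} {ε : ℝ} (h0 : 0 ≤ ε) (h1 : ε ≤ 1) (σ : Fin m → Bool)
    (k : Fin m × Bool) : 0 ≤ pairWeight ε σ k := by
  unfold pairWeight bitSign
  apply div_nonneg _ (by positivity)
  split_ifs <;> linarith

theorem sum_pairWeight {m : ℕ} (hm : 0 < m) (ε : ℝ) (σ : Fin m → Bool) :
    ∑ k, pairWeight ε σ k = 1 := by
  have hm' : (0 : ℝ) < m := by exact_mod_cast hm
  rw [Fintype.sum_prod_type]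
  have : ∀ j : Fin m, ∑ b, pairWeight ε σ (j, b) = 1 / m := by
    intro j
    simp only [Fintype.sum_bool, pairWeight, bitSign_true]
    field_simp
    ring
  simp_rw [this]
  simp [hm'.ne']

/-- Flipping one bit changes only one pair, of mass 1/m, and there the affinity loses at most the
fraction ε², since √(1 - ε²) ≥ 1 - ε². The choice of ε makes this loss 1/(16n), as the product bound
requires. -/
theorem affinity_pairWeight {m n : ℕ} (hm : 0 < m) {ε : ℝ} (h0 : 0 ≤ ε) (h1 : ε ≤ 1)
    (hε : ε ^ 2 = m / (16 * n)) (σ : Fin m → Bool) (j : Fin m) :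
    1 - 1 / (16 * n : ℝ) ≤
      ∑ k, √(pairWeight ε σ k * pairWeight ε (Function.update σ j (!σ j)) k) := by
  have hm' : (0 : ℝ) < m := by exact_mod_cast hm
  have key : ∀ i : Fin m, 1 / m - (if i = j then ε ^ 2 / m else 0) ≤
      ∑ b, √(pairWeight ε σ (i, b) * pairWeight ε (Function.update σ j (!σ j)) (i, b)) := by
    intro i
    by_cases hij : i = j
    · subst hij
      have hb : ∀ b, (1 - ε ^ 2) / (2 * m) ≤
          √(pairWeight ε σ (i, b) * pairWeight ε (Function.update σ i (!σ i)) (i, b)) := by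
        intro b
        apply Real.le_sqrt_of_sq_le
        have : pairWeight ε σ (i, b) * pairWeight ε (Function.update σ i (!σ i)) (i, b) =
            (1 - ε ^ 2) / (2 * m) ^ 2 := by
          simp only [pairWeight, Function.update_self]
          cases σ i <;> cases b <;> simp [bitSign] <;> field_simp <;> ring
        rw [this, div_pow]
        have : ε ^ 2 ≤ 1 := pow_le_one₀ h0 h1
        gcongr
        nlinarith [sq_nonneg ε]
      have := hb true
      have := hb false
      rw [Fintype.sum_bool, if_pos rfl]
      calc 1 / (m : ℝ) - ε ^ 2 / m = (1 - ε ^ 2) / (2 * m) + (1 - ε ^ 2) / (2 * m) := by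
            field_simp; ring
        _ ≤ _ := by linarith
    · have hb : ∀ b, √(pairWeight ε σ (i, b) *
          pairWeight ε (Function.update σ j (!σ j)) (i, b)) = pairWeight ε σ (i, b) := by
        intro b
        have : pairWeight ε (Function.update σ j (!σ j)) (i, b) = pairWeight ε σ (i, b) := by
          simp [pairWeight, Function.update_of_ne hij]
        rw [this, Real.sqrt_mul_self (pairWeight_nonneg h0 h1 _ _)]
      rw [Fintype.sum_bool, hb, hb, if_neg hij, pairWeight, pairWeight, bitSign_true]
      apply le_of_eq
      field_simp
      ring
  rw [Fintype.sum_prod_type]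
  refine le_trans (le_of_eq ?_) (Finset.sum_le_sum fun i _ => key i)
  rw [Finset.sum_sub_distrib, Finset.sum_ite_eq' Finset.univ j, if_pos (Finset.mem_univ _), hε]
  -- For n = 0 both quotients by 16n are 0 by convention.
  rcases Nat.eq_zero_or_pos n with rfl | hn
  · simp [hm'.ne']
  · have hn' : (0 : ℝ) < n := by exact_mod_cast hn
    simp only [Finset.sum_const, Finset.card_univ, Fintype.card_fin, nsmul_eq_mul]
    field_simp

/-- Assouad's lemma for the perturbed uniform distributions on `m` pairs. -/
theorem exists_pairWeight_risk_ge {m n : ℕ} (hm : 0 < m) (hn : 0 < n) {ε : ℝ} (h0 : 0 ≤ ε)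
    (h1 : ε ≤ 1) (hε : ε ^ 2 = m / (16 * n)) (D : (Fin n → Fin m × Bool) → Fin m → ℝ)
    (hD : ∀ s j, |D s j| ≤ 1) :
    ∃ σ : Fin m → Bool, ε * (5 / 16) ≤ ∑ s, (∏ i, pairWeight ε σ (s i)) *
      (ε / 2 - ε / (2 * m) * ∑ j, bitSign (σ j) true * D s j) := by
  have hm' : (0 : ℝ) < m := by exact_mod_cast hm
  set P : (Fin m → Bool) → (Fin n → Fin m × Bool) → ℝ := fun σ s => ∏ i, pairWeight ε σ (s i)
    with hP
  have hP1 : ∀ σ, ∑ s, P σ s = 1 := fun σ => by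
    rw [← Fintype.sum_pow (pairWeight ε σ) n, sum_pairWeight hm, one_pow]
  have hj : ∀ j, ∑ σ, ∑ s, P σ s * (bitSign (σ j) true * D s j) ≤
      ∑ _σ : Fin m → Bool, (3 / 8 : ℝ) := by
    intro j
    -- Pair σ with its flip at j: the sign changes while `D s j` stays, so the two terms together
    -- are at most the L¹ distance of the two laws. Each bit thus contributes at most 3/8 on
    -- average.
    have hinv : Function.Involutive fun σ : Fin m → Bool => Function.update σ j (!σ j) := by
      intro σ; simp
    have h2 := Equiv.sum_comp (hinv.toPerm _)
      fun σ => ∑ s, P σ s * (bitSign (σ j) true * D s j)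
    have h3 : 2 * ∑ σ, ∑ s, P σ s * (bitSign (σ j) true * D s j) ≤
        ∑ _σ : Fin m → Bool, (3 / 4 : ℝ) := by
      rw [two_mul]
      nth_rewrite 2 [← h2]
      rw [← Finset.sum_add_distrib]
      refine Finset.sum_le_sum fun σ _ => ?_
      refine le_trans ?_ (sum_abs_prod_sub_prod_le (pairWeight_nonneg h0 h1 σ)
        (pairWeight_nonneg h0 h1 (Function.update σ j (!σ j))) (sum_pairWeight hm _ _)
        (sum_pairWeight hm _ _) hn (affinity_pairWeight hm h0 h1 hε σ j))
      rw [← Finset.sum_add_distrib]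
      refine Finset.sum_le_sum fun s _ => ?_
      have : bitSign (!σ j) true = - bitSign (σ j) true := by cases σ j <;> simp [bitSign]
      simp only [Function.Involutive.coe_toPerm, Function.update_self, this]
      calc _ = (P σ s - P (Function.update σ j (!σ j)) s) * (bitSign (σ j) true * D s j) := by
            ring
        _ ≤ |(P σ s - P (Function.update σ j (!σ j)) s) * (bitSign (σ j) true * D s j)| :=
            le_abs_self _
        _ ≤ |P σ s - P (Function.update σ j (!σ j)) s| * 1 := by
            rw [abs_mul, abs_mul, abs_bitSign, one_mul]
            gcongr
            exact hD s j
        _ = _ := by rw [mul_one]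
    simp only [Finset.sum_const, nsmul_eq_mul] at h3 ⊢
    linarith
  have hsum : ∑ _σ : Fin m → Bool, ε * (5 / 16) ≤ ∑ σ, ∑ s, P σ s *
      (ε / 2 - ε / (2 * m) * ∑ j, bitSign (σ j) true * D s j) := by
    have e1 : ∀ σ, ∑ s, P σ s * (ε / 2 - ε / (2 * m) * ∑ j, bitSign (σ j) true * D s j) =
        ε / 2 - ε / (2 * m) * ∑ j, ∑ s, P σ s * (bitSign (σ j) true * D s j) := by
      intro σ
      rw [Finset.sum_comm, Finset.mul_sum]
      simp_rw [mul_sub, Finset.sum_sub_distrib, ← Finset.sum_mul, hP1, one_mul]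
      congr 1
      refine Finset.sum_congr rfl fun s _ => ?_
      rw [← Finset.mul_sum]; ring
    simp_rw [e1]
    rw [Finset.sum_sub_distrib, ← Finset.mul_sum (f := fun σ => ∑ j, ∑ s, P σ s *
      (bitSign (σ j) true * D s j)), Finset.sum_comm]
    have h4 := Finset.sum_le_sum fun j (_ : j ∈ Finset.univ) => hj j
    have h5 : ε / (2 * m) * ∑ j, ∑ σ, ∑ s, P σ s * (bitSign (σ j) true * D s j) ≤
        ε / (2 * m) * ∑ _j : Fin m, ∑ _σ : Fin m → Bool, (3 / 8 : ℝ) := by gcongr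
    simp only [Finset.sum_const, nsmul_eq_mul, Finset.card_univ, Fintype.card_fin] at h5 ⊢
    have h6 : ε / (2 * m) * (m * ((Fintype.card (Fin m → Bool) : ℝ) * (3 / 8))) =
        Fintype.card (Fin m → Bool) * (ε * (3 / 16)) := by field_simp; ring
    rw [h6] at h5
    linarith
  obtain ⟨σ, -, h⟩ := Finset.exists_le_of_sum_le Finset.univ_nonempty hsum
  exact ⟨σ, h⟩

end NeymanPearson

/-! ### Lower bounds through finitely supported alternatives -/

namespace NeymanPearson

variable {X : Type u} [MeasurableSpace X]

theorem risk₁_nonneg (μ : ProbabilityMeasure X) (h : X → Bool) : 0 ≤ risk₁ μ h :=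
  measureReal_nonneg

theorem bddBelow_risk₁ (μ : ProbabilityMeasure X) (F : Set (X → Bool)) :
    BddBelow (risk₁ μ '' F) :=
  ⟨0, by rintro _ ⟨h, -, rfl⟩; exact risk₁_nonneg μ h⟩

theorem sub_le_excessRisk {H : Set (X → Bool)} {α : ℝ} {μ₀ : ProbabilityMeasure X}
    (μ₁ : ProbabilityMeasure X) (h : X → Bool) {h' : X → Bool} (hh' : h' ∈ level H α μ₀) :
    risk₁ μ₁ h - risk₁ μ₁ h' ≤ excessRisk H α μ₀ μ₁ h := by
  refine le_trans ?_ (le_max_right _ _)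
  have := csInf_le (bddBelow_risk₁ μ₁ (level H α μ₀)) ⟨h', hh', rfl⟩
  linarith

theorem upperExp_le_minimaxRisk {H : Set (X → Bool)} {α : ℝ} {μ₀ : ProbabilityMeasure X} {n : ℕ}
    (hne : (level H α μ₀).Nonempty) {B : ℝ≥0∞}
    (h : ∀ A : ExactLearner H α μ₀ n, ∃ μ₁ : ProbabilityMeasure X, B ≤
      upperExp (iidLaw μ₁ n) fun S => ENNReal.ofReal (excessRisk H α μ₀ μ₁ (A S))) :
    B ≤ minimaxRisk H α μ₀ n := by
  refine le_iInf fun A => ?_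
  obtain ⟨μ₁, hμ⟩ := h A
  exact hμ.trans (le_iSup₂_of_le μ₁ hne le_rfl)

section Atomic

variable [MeasurableSingletonClass X]

/-- The measure with atoms of weight `w k` at the points `x k`. -/
noncomputable def atomicMeasure {κ : Type*} [Fintype κ] (w : κ → ℝ) (x : κ → X) : Measure X :=
  ∑ k, ENNReal.ofReal (w k) • Measure.dirac (x k)

theorem atomicMeasure_apply {κ : Type*} [Fintype κ] {w : κ → ℝ} (hw : ∀ k, 0 ≤ w k) (x : κ → X)
    (s : Set X) [DecidablePred (· ∈ s)] :
    atomicMeasure w x s = ENNReal.ofReal (∑ k, if x k ∈ s then w k else 0) := by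
  rw [atomicMeasure, ENNReal.ofReal_sum_of_nonneg
    (fun k _ => by split_ifs; exacts [hw k, le_rfl])]
  simp only [Measure.coe_finsetSum, Finset.sum_apply, Measure.smul_apply, smul_eq_mul,
    Measure.dirac_apply, Set.indicator_apply, Pi.one_apply]
  refine Finset.sum_congr rfl fun k _ => ?_
  split_ifs <;> simp

/-- The probability measure with atoms of weight `w k` at the points `x k`. -/
noncomputable def atomicProb {κ : Type*} [Fintype κ] (w : κ → ℝ) (hw : ∀ k, 0 ≤ w k)
    (h1 : ∑ k, w k = 1) (x : κ → X) : ProbabilityMeasure X :=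
  ⟨atomicMeasure w x, ⟨by classical rw [atomicMeasure_apply hw]; simp [h1]⟩⟩

theorem atomicProb_real {κ : Type*} [Fintype κ] {w : κ → ℝ} (hw : ∀ k, 0 ≤ w k)
    (h1 : ∑ k, w k = 1) (x : κ → X) (s : Set X) [DecidablePred (· ∈ s)] :
    (atomicProb w hw h1 x : Measure X).real s = ∑ k, if x k ∈ s then w k else 0 := by
  change (atomicMeasure w x s).toReal = _
  rw [atomicMeasure_apply hw, ENNReal.toReal_ofReal]
  exact Finset.sum_nonneg fun k _ => by split_ifs; exacts [hw k, le_rfl]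

theorem le_atomicProb_singleton {κ : Type*} [Fintype κ] {w : κ → ℝ} (hw : ∀ k, 0 ≤ w k)
    (h1 : ∑ k, w k = 1) (x : κ → X) (k : κ) :
    ENNReal.ofReal (w k) ≤ (atomicProb w hw h1 x : Measure X) {x k} := by
  classical
  change _ ≤ atomicMeasure w x {x k}
  rw [atomicMeasure_apply hw]
  refine ENNReal.ofReal_le_ofReal ?_
  refine le_trans (le_of_eq (by simp)) (Finset.single_le_sum (f := fun i =>
    if x i ∈ ({x k} : Set X) then w i else 0) (fun i _ => by
      split_ifs; exacts [hw i, le_rfl]) (Finset.mem_univ k))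

/-- Every majorant is bounded below on atoms by `f` itself, so lower bounds need no measurability of
the learner. -/
theorem sum_le_upperExp {Ω : Type u} [MeasurableSpace Ω] [MeasurableSingletonClass Ω]
    {κ : Type*} [Fintype κ] (P : Measure Ω) (f : Ω → ℝ≥0∞) {y : κ → Ω}
    (hy : Function.Injective y) : ∑ k, P {y k} * f (y k) ≤ upperExp P f := by
  classical
  refine le_iInf₂ fun g _ => le_iInf fun hfg => ?_
  calc ∑ k, P {y k} * f (y k) ≤ ∑ k, g (y k) * P {y k} :=
        Finset.sum_le_sum fun k _ => by rw [mul_comm]; gcongr; exact hfg _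
    _ = ∫⁻ ω in (Finset.univ.image y : Finset Ω), g ω ∂P := by
        rw [lintegral_finset, Finset.sum_image fun a _ b _ h => hy h]
    _ ≤ ∫⁻ ω, g ω ∂P := setLIntegral_le_lintegral _ _

theorem le_iidLaw_atomicProb_singleton {κ : Type*} [Fintype κ] {w : κ → ℝ} (hw : ∀ k, 0 ≤ w k)
    (h1 : ∑ k, w k = 1) (x : κ → X) {n : ℕ} (s : Fin n → κ) :
    ENNReal.ofReal (∏ i, w (s i)) ≤ iidLaw (atomicProb w hw h1 x) n {x ∘ s} := by
  rw [iidLaw, Measure.pi_singleton, ENNReal.ofReal_prod_of_nonneg fun i _ => hw _]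
  exact Finset.prod_le_prod' fun i _ => le_atomicProb_singleton hw h1 x (s i)

/-- Nested hypotheses without a maximal element: the risk is at least of order `1 / n`. -/
theorem inv_le_minimaxRisk {H : Set (X → Bool)} {α : ℝ} {μ₀ : ProbabilityMeasure X}
    (hchain : ∀ h ∈ level H α μ₀, ∀ h' ∈ level H α μ₀,
      (∀ x, h x = true → h' x = true) ∨ (∀ x, h' x = true → h x = true))
    (hmax : ¬ AdmitsMaximal (level H α μ₀)) (hne : (level H α μ₀).Nonempty)
    {n : ℕ} (hn : 0 < n) :
    ENNReal.ofReal (1 / (4 * n)) ≤ minimaxRisk H α μ₀ n := by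
  classical
  refine upperExp_le_minimaxRisk hne fun A => ?_
  have hn' : (1 : ℝ) ≤ n := by exact_mod_cast hn
  obtain ⟨g, hg⟩ := hne
  have hX : Nonempty X := (μ₀ : Measure X).nonempty_of_neZero
  obtain ⟨x₀⟩ := hX
  set S₀ : Fin n → X := fun _ => x₀
  set h : X → Bool := (A S₀ : X → Bool) with hh
  have hhl : h ∈ level H α μ₀ := (A S₀).2
  -- The alternative is built after seeing the learner's answer to the constant sample.
  obtain ⟨h', hh', x₁, hx₁', hx₁⟩ : ∃ h' ∈ level H α μ₀, ∃ x₁, h' x₁ = true ∧ h x₁ = false := by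
    by_contra hcon
    push Not at hcon
    refine hmax ⟨h, hhl, fun h' hh' x hx => ?_⟩
    have := hcon h' hh' x hx
    simpa using this
  have hsub : ∀ x, h x = true → h' x = true := by
    rcases hchain h hhl h' hh' with hs | hs
    · exact hs
    · exact absurd (hs x₁ hx₁') (by simp [hx₁])
  let w : Bool → ℝ := fun b => if b then 1 / (2 * n) else 1 - 1 / (2 * n)
  have hninv : (1 : ℝ) / (2 * n) ≤ 1 / 2 :=
    one_div_le_one_div_of_le (by norm_num) (by linarith)
  have hw : ∀ b, 0 ≤ w b := by
    intro b
    cases b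
    · simp only [w]; simp only [Bool.false_eq_true, if_false]; linarith
    · simp only [w, if_true]; positivity
  have hw1 : ∑ b, w b = 1 := by simp [w]
  let x : Bool → X := fun b => if b then x₁ else x₀
  refine ⟨atomicProb w hw hw1 x, ?_⟩
  set μ₁ := atomicProb w hw hw1 x with hμ₁
  have hex : 1 / (2 * n : ℝ) ≤ excessRisk H α μ₀ μ₁ h := by
    refine le_trans ?_ (sub_le_excessRisk μ₁ h hh')
    have e1 : risk₁ μ₁ h = ∑ k, if x k ∈ {x | h x = false} then w k else 0 :=
      atomicProb_real hw hw1 x _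
    have e2 : risk₁ μ₁ h' = ∑ k, if x k ∈ {x | h' x = false} then w k else 0 :=
      atomicProb_real hw hw1 x _
    rw [e1, e2, Fintype.sum_bool, Fintype.sum_bool]
    simp only [x, w, if_true, Bool.false_eq_true, if_false, Set.mem_ofPred_eq, hx₁, hx₁',
      Bool.true_eq_false]
    have h0 : (0 : ℝ) ≤ 1 - 1 / (2 * n) := by linarith
    have : (if h' x₀ = false then (1 - 1 / (2 * n) : ℝ) else 0) ≤
        if h x₀ = false then (1 - 1 / (2 * n) : ℝ) else 0 := by
      by_cases hc : h' x₀ = false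
      · have : h x₀ = false := by
          by_contra hc'
          simp [hsub x₀ (by simpa using hc')] at hc
        simp [hc, this]
      · rw [if_neg hc]; split_ifs; exacts [h0, le_rfl]
    linarith
  have hprob : ENNReal.ofReal (1 / 2) ≤ iidLaw μ₁ n {S₀} := by
    refine le_trans ?_ (le_iidLaw_atomicProb_singleton hw hw1 x (fun _ : Fin n => false))
    refine ENNReal.ofReal_le_ofReal ?_
    simp only [Finset.prod_const, Finset.card_univ, Fintype.card_fin, w, Bool.false_eq_true,
      if_false]
    calc (1 / 2 : ℝ) = 1 + n * (-(1 / (2 * n))) := by field_simp; norm_num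
      _ ≤ (1 + -(1 / (2 * n))) ^ n := one_add_mul_le_pow (by linarith) n
  refine le_trans ?_ (sum_le_upperExp (κ := Unit) (y := fun _ => S₀) _ _
    (Function.injective_of_subsingleton _))
  simp only [Finset.univ_unique, Finset.sum_const, Finset.card_singleton, one_smul]
  calc ENNReal.ofReal (1 / (4 * n)) = ENNReal.ofReal (1 / 2) * ENNReal.ofReal (1 / (2 * n)) := by
        rw [← ENNReal.ofReal_mul (by norm_num)]; congr 1; field_simp; norm_num
    _ ≤ _ := by gcongr

end Atomic

end NeymanPearson

/-! ### Systems of pairs from shattering or from three-point separation -/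

namespace NeymanPearson

variable {X : Type u}

/-- `m` pairs of points and a base point, such that members of `H` select arbitrary
representatives of the pairs while avoiding the base point. -/
structure PairSystem (H : Set (X → Bool)) (m : ℕ) where
  /-- The base point and the points of the pairs. -/
  pt : Option (Fin m × Bool) → X
  inj : Function.Injective pt
  /-- The hypothesis that selects the representatives `σ`. -/
  sel : (Fin m → Bool) → X → Bool
  sel_mem : ∀ σ, sel σ ∈ H
  sel_base : ∀ σ, sel σ (pt none) = false
  sel_pair : ∀ σ j b, sel σ (pt (some (j, b))) = decide (σ j = b)

theorem exists_pairSystem_of_shatters {H : Set (X → Bool)} {s : Finset X} (hs : Shatters H s)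
    {m : ℕ} (hm : 2 * m + 1 ≤ s.card) : Nonempty (PairSystem H m) := by
  classical
  obtain ⟨e⟩ : Nonempty (Option (Fin m × Bool) ↪ s) := by
    apply Function.Embedding.nonempty_of_card_le
    simp; omega
  have hinj : Function.Injective fun k => (e k : X) :=
    Subtype.val_injective.comp e.injective
  choose g hgH hg using fun σ : Fin m → Bool =>
    hs fun x => decide (∃ j, x = e (some (j, σ j)))
  refine ⟨⟨fun k => e k, hinj, g, hgH, fun σ => ?_, fun σ j b => ?_⟩⟩
  · rw [hg σ _ (e none).2]
    simp
  · rw [hg σ _ (e (some (j, b))).2]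
    simp only [decide_eq_decide, Subtype.val_inj, e.injective.eq_iff, Option.some.injEq,
      Prod.mk.injEq]
    constructor
    · rintro ⟨j', rfl, rfl⟩; rfl
    · rintro rfl; exact ⟨j, rfl, rfl⟩

theorem exists_pairSystem_of_separatesThreePoints {H : Set (X → Bool)}
    (hH : SeparatesThreePoints H) : Nonempty (PairSystem H 1) := by
  obtain ⟨h₁, hh₁, h₂, hh₂, x₀, x₁, x₂, ⟨a, b⟩, c, d, e, f⟩ := hH
  have h01 : x₀ ≠ x₁ := by rintro rfl; simp_all
  have h02 : x₀ ≠ x₂ := by rintro rfl; simp_all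
  have h12 : x₁ ≠ x₂ := by rintro rfl; simp_all
  refine ⟨⟨fun k => k.elim x₀ fun p => if p.2 then x₁ else x₂, ?_,
    fun σ => if σ 0 then h₁ else h₂, ?_, ?_, ?_⟩⟩
  · rintro (_ | ⟨i, _ | _⟩) (_ | ⟨j, _ | _⟩) h <;>
      simp [h01, h02, h12, h01.symm, h02.symm, h12.symm] at h ⊢ <;> exact Subsingleton.elim _ _
  · intro σ; split_ifs <;> assumption
  · intro σ; cases σ 0 <;> simp [a, b]
  · intro σ j b
    rw [Subsingleton.elim j 0]
    cases σ 0 <;> cases b <;> simp [c, d, e, f]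

theorem shatters_singleton {H : Set (X → Bool)} {h₁ h₂ : X → Bool} (hh₁ : h₁ ∈ H) (hh₂ : h₂ ∈ H)
    {x : X} (hx₁ : h₁ x = true) (hx₂ : h₂ x = false) : Shatters H {x} := by
  intro b
  cases hb : b x
  · exact ⟨h₂, hh₂, by simp [hb, hx₂]⟩
  · exact ⟨h₁, hh₁, by simp [hb, hx₁]⟩

theorem HasVCDim.one_le {H : Set (X → Bool)} {d : ℕ} (hd : HasVCDim H d) {h₁ h₂ : X → Bool}
    (hh₁ : h₁ ∈ H) (hh₂ : h₂ ∈ H) {x : X} (hx₁ : h₁ x = true) (hx₂ : h₂ x = false) : 1 ≤ d :=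
  hd.2 ⟨{x}, by simp, shatters_singleton hh₁ hh₂ hx₁ hx₂⟩

theorem SeparatesThreePoints.one_le {H : Set (X → Bool)} (hH : SeparatesThreePoints H) {d : ℕ}
    (hd : HasVCDim H d) : 1 ≤ d := by
  obtain ⟨h₁, hh₁, h₂, hh₂, x₀, x₁, x₂, ⟨a, b⟩, c, d, e, f⟩ := hH
  exact hd.one_le hh₁ hh₂ c f

/-- A class of VC dimension at least three separates three points. -/
theorem HasVCDim.le_two {H : Set (X → Bool)} {d : ℕ} (hd : HasVCDim H d)
    (hH : ¬ SeparatesThreePoints H) : d ≤ 2 := by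
  by_contra hlt
  obtain ⟨s, hs, hsh⟩ := hd.1
  obtain ⟨P⟩ := exists_pairSystem_of_shatters hsh (m := 1) (by omega)
  refine hH ⟨P.sel fun _ => true, P.sel_mem _, P.sel fun _ => false, P.sel_mem _, P.pt none,
    P.pt (some (0, true)), P.pt (some (0, false)), ⟨P.sel_base _, P.sel_base _⟩, ?_⟩
  simp [P.sel_pair]

theorem SeparatesThreePoints.exists_pairSystem {H : Set (X → Bool)} (hH : SeparatesThreePoints H)
    {d : ℕ} (hd : HasVCDim H d) :
    ∃ m, 0 < m ∧ m ≤ d ∧ d ≤ 6 * m ∧ Nonempty (PairSystem H m) := by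
  have := hH.one_le hd
  by_cases h3 : d ≤ 2
  · exact ⟨1, by omega, by omega, by omega, exists_pairSystem_of_separatesThreePoints hH⟩
  · obtain ⟨s, hs, hsh⟩ := hd.1
    exact ⟨(d - 1) / 2, by omega, by omega, by omega,
      exists_pairSystem_of_shatters hsh (by omega)⟩

/-! ### Lower bound of order √(m / n) -/

variable [MeasurableSpace X] [MeasurableSingletonClass X]

theorem PairSystem.exists_forall_le_minimaxRisk {H : Set (X → Bool)} {m : ℕ} (P : PairSystem H m)
    (hm : 0 < m) {α : ℝ} (hα0 : 0 < α) (hα : α < 1 / 2) :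
    ∃ μ₀ : ProbabilityMeasure X, (level H α μ₀).Nonempty ∧ ∀ n : ℕ, m ≤ n →
      ENNReal.ofReal (5 / 64 * √((m : ℝ) / n)) ≤ minimaxRisk H α μ₀ n := by
  classical
  have hm' : (0 : ℝ) < m := by exact_mod_cast hm
  -- The pair points share mass 2α, so one representative per pair costs exactly α; the base point
  -- absorbs the remaining 1 - 2α.
  let w : Option (Fin m × Bool) → ℝ := fun k => k.elim (1 - 2 * α) fun _ => α / m
  have hw : ∀ k, 0 ≤ w k := by
    rintro (_ | k)
    · simp only [w, Option.elim]; linarith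
    · simp only [w, Option.elim]; positivity
  have hw1 : ∑ k, w k = 1 := by
    rw [Fintype.sum_option]
    simp only [w, Option.elim, Finset.sum_const, Finset.card_univ, Fintype.card_prod,
      Fintype.card_fin, Fintype.card_bool, nsmul_eq_mul]
    push_cast
    field_simp
    ring
  set μ₀ := atomicProb w hw hw1 P.pt with hμ₀
  have hrisk₀ : ∀ h, risk₀ μ₀ h = (if h (P.pt none) = true then 1 - 2 * α else 0) +
      ∑ k, if h (P.pt (some k)) = true then α / m else 0 := by
    intro h
    have := atomicProb_real hw hw1 P.pt {x | h x = true}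
    rw [Fintype.sum_option] at this
    exact this
  have hsel : ∀ σ, P.sel σ ∈ level H α μ₀ := by
    refine fun σ => ⟨P.sel_mem σ, ?_⟩
    rw [hrisk₀, P.sel_base, Fintype.sum_prod_type]
    simp only [P.sel_pair, decide_eq_true_eq, Finset.sum_ite_eq, Finset.mem_univ, if_true]
    simp
    field_simp
    exact le_rfl
  have hne : (level H α μ₀).Nonempty := ⟨_, hsel fun _ => true⟩
  refine ⟨μ₀, hne, fun n hmn => upperExp_le_minimaxRisk hne fun A => ?_⟩
  have hn : 0 < n := hm.trans_le hmn
  have hn' : (0 : ℝ) < n := by exact_mod_cast hn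
  set ε : ℝ := √((m : ℝ) / n) / 4 with hεdef
  have h0 : 0 ≤ ε := by positivity
  have h1 : ε ≤ 1 := by
    have : √((m : ℝ) / n) ≤ 1 := by
      rw [Real.sqrt_le_one, div_le_one hn']; exact_mod_cast hmn
    rw [hεdef]; linarith
  have hε : ε ^ 2 = m / (16 * n) := by
    rw [hεdef, div_pow, Real.sq_sqrt (by positivity)]; field_simp; norm_num
  let y : Fin m × Bool → X := fun k => P.pt (some k)
  have hy : Function.Injective y := P.inj.comp (Option.some_injective _)
  let a : (X → Bool) → Fin m × Bool → ℝ := fun h k => if h (y k) = true then 1 else 0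
  have ha : ∀ h ∈ level H α μ₀, ∑ k, a h k ≤ m := by
    intro h hh
    have h2 := hh.2
    rw [hrisk₀] at h2
    have h3 : ∑ k, (if h (P.pt (some k)) = true then α / m else 0) = α / m * ∑ k, a h k := by
      rw [Finset.mul_sum]
      exact Finset.sum_congr rfl fun k _ => by simp [a, y]
    rw [h3] at h2
    have h4 : 0 ≤ if h (P.pt none) = true then 1 - 2 * α else 0 := by
      split_ifs <;> linarith
    have h5 : α / m * ∑ k, a h k ≤ α / m * m := by
      rw [div_mul_cancel₀ _ hm'.ne']; linarith
    exact le_of_mul_le_mul_left h5 (by positivity)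
  let D : (Fin n → Fin m × Bool) → Fin m → ℝ := fun s j =>
    a (A (y ∘ s)) (j, true) - a (A (y ∘ s)) (j, false)
  have hD : ∀ s j, |D s j| ≤ 1 := by
    intro s j
    simp only [D, a]
    split_ifs <;> simp
  obtain ⟨σ, hσ⟩ := exists_pairWeight_risk_ge hm hn h0 h1 hε D hD
  have hp := pairWeight_nonneg h0 h1 σ
  have hp1 := sum_pairWeight hm ε σ
  set μ₁ := atomicProb (pairWeight ε σ) hp hp1 y with hμ₁
  refine ⟨μ₁, ?_⟩
  have hrisk₁ : ∀ h, risk₁ μ₁ h = 1 - ∑ k, pairWeight ε σ k * a h k := by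
    intro h
    have := atomicProb_real hp hp1 y {x | h x = false}
    refine this.trans ?_
    rw [← hp1, ← Finset.sum_sub_distrib]
    refine Finset.sum_congr rfl fun k _ => ?_
    by_cases hk : h (y k) = true <;> simp [a, hk]
  have hriskσ : risk₁ μ₁ (P.sel σ) = (1 - ε) / 2 := by
    rw [hrisk₁, Fintype.sum_prod_type]
    have : ∀ j, ∑ b, pairWeight ε σ (j, b) * a (P.sel σ) (j, b) = (1 + ε) / (2 * m) := by
      intro j
      simp only [a, y, P.sel_pair, decide_eq_true_eq, mul_ite, mul_one, mul_zero,
        Finset.sum_ite_eq, Finset.mem_univ, if_true, pairWeight, bitSign]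
    simp_rw [this]
    simp only [Finset.sum_const, Finset.card_univ, Fintype.card_fin, nsmul_eq_mul]
    field_simp
    ring
  -- At most m pair points are selected, so the unperturbed part of the captured mass is at most
  -- 1/2, and only the tilt toward `σ` distinguishes hypotheses.
  have hexcess : ∀ s, ε / 2 - ε / (2 * m) * ∑ j, bitSign (σ j) true * D s j ≤
      excessRisk H α μ₀ μ₁ (A (y ∘ s)) := by
    intro s
    refine le_trans ?_ (sub_le_excessRisk μ₁ _ (hsel σ))
    rw [hriskσ, hrisk₁]
    have h2 := ha _ (A (y ∘ s)).2
    have h3 : ∑ k, pairWeight ε σ k * a (A (y ∘ s)) k = 1 / (2 * m) * ∑ k, a (A (y ∘ s)) k +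
        ε / (2 * m) * ∑ j, bitSign (σ j) true * D s j := by
      rw [Fintype.sum_prod_type, Fintype.sum_prod_type, Finset.mul_sum, Finset.mul_sum,
        ← Finset.sum_add_distrib]
      refine Finset.sum_congr rfl fun j _ => ?_
      rw [Fintype.sum_bool, Fintype.sum_bool]
      simp only [pairWeight, D, bitSign_true]
      ring
    have h4 : 1 / (2 * m : ℝ) * ∑ k, a (A (y ∘ s)) k ≤ 1 / 2 := by
      calc 1 / (2 * m : ℝ) * ∑ k, a (A (y ∘ s)) k ≤ 1 / (2 * m : ℝ) * m := by gcongr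
        _ = 1 / 2 := by field_simp
    rw [h3]
    linarith
  refine le_trans ?_ (sum_le_upperExp (κ := Fin n → Fin m × Bool) (y := fun s => y ∘ s) _ _
    hy.comp_left)
  have hstep : ∀ s : Fin n → Fin m × Bool, ENNReal.ofReal ((∏ i, pairWeight ε σ (s i)) *
      (ε / 2 - ε / (2 * m) * ∑ j, bitSign (σ j) true * D s j)) ≤ iidLaw μ₁ n {y ∘ s} *
      ENNReal.ofReal (excessRisk H α μ₀ μ₁ (A (y ∘ s))) := by
    intro s
    rw [ENNReal.ofReal_mul (Finset.prod_nonneg fun i _ => hp _)]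
    exact mul_le_mul' (le_iidLaw_atomicProb_singleton hp hp1 y s)
      (ENNReal.ofReal_le_ofReal (hexcess s))
  refine le_trans ?_ (Finset.sum_le_sum fun s _ => hstep s)
  refine le_trans (ENNReal.ofReal_le_ofReal ?_) (Finset.le_sum_of_subadditive ENNReal.ofReal
    ENNReal.ofReal_zero.le (fun _ _ => ENNReal.ofReal_add_le) _ _)
  refine le_trans (le_of_eq ?_) hσ
  rw [hεdef]; ring

end NeymanPearson

/-! ### Exponential moments, pattern counting and symmetrization -/

namespace NeymanPearson

/-- A maximal inequality from exponential moments on a finite uniform probability space. -/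
theorem exists_sum_le_log_of_sum_exp_le {Ω ι : Type*} [Fintype Ω] [Nonempty Ω] (P : Finset ι)
    (v : ι → Ω → ℝ) {c M : ℝ} (hc : 0 < c)
    (hM : ∀ p ∈ P, ∑ ω, Real.exp (c * v p ω) ≤ Fintype.card Ω * M) :
    ∃ W : Ω → ℝ, (∀ ω, 0 ≤ W ω) ∧ (∀ p ∈ P, ∀ ω, v p ω ≤ W ω) ∧
      ∑ ω, W ω ≤ Fintype.card Ω * (Real.log (1 + P.card * M) / c) := by
  have hΩ : (0 : ℝ) < Fintype.card Ω := by exact_mod_cast Fintype.card_pos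
  -- A soft maximum: log `Y` / c dominates every `v p`. The extra 1 makes it nonnegative, and Jensen
  -- for log bounds its mean.
  set Y : Ω → ℝ := fun ω => 1 + ∑ p ∈ P, Real.exp (c * v p ω) with hY
  have hYnn : ∀ ω, 0 ≤ ∑ p ∈ P, Real.exp (c * v p ω) := fun ω =>
    Finset.sum_nonneg fun p _ => (Real.exp_pos _).le
  have hY1 : ∀ ω, 1 ≤ Y ω := fun ω => by simp only [hY]; linarith [hYnn ω]
  have hY0 : ∀ ω, 0 < Y ω := fun ω => one_pos.trans_le (hY1 ω)
  refine ⟨fun ω => Real.log (Y ω) / c, fun ω => ?_, fun p hp ω => ?_, ?_⟩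
  · exact div_nonneg (Real.log_nonneg (hY1 ω)) hc.le
  · rw [le_div_iff₀ hc, mul_comm, Real.le_log_iff_exp_le (hY0 ω)]
    have := Finset.single_le_sum (f := fun p => Real.exp (c * v p ω))
      (fun p _ => (Real.exp_pos _).le) hp
    simp only [hY]
    linarith
  · rw [← Finset.sum_div, ← mul_div_assoc]
    gcongr
    have hjen := strictConcaveOn_log_Ioi.concaveOn.le_map_sum (t := Finset.univ)
      (w := fun _ : Ω => (1 / Fintype.card Ω : ℝ)) (p := Y) (fun _ _ => by positivity)
      (by simp [hΩ.ne']) (fun ω _ => hY0 ω)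
    simp only [smul_eq_mul] at hjen
    rw [← Finset.mul_sum, ← Finset.mul_sum] at hjen
    have hsumY : 1 / (Fintype.card Ω : ℝ) * ∑ ω, Y ω ≤ 1 + P.card * M := by
      rw [one_div, inv_mul_le_iff₀ hΩ]
      simp only [hY]
      rw [Finset.sum_add_distrib, Finset.sum_comm]
      have := Finset.sum_le_sum hM
      simp only [Finset.sum_const, nsmul_eq_mul, Finset.card_univ, mul_one] at this ⊢
      linarith
    have hpos : 0 < 1 / (Fintype.card Ω : ℝ) * ∑ ω, Y ω :=
      mul_pos (by positivity) (Finset.sum_pos (fun ω _ => hY0 ω) Finset.univ_nonempty)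
    have := hjen.trans (Real.log_le_log hpos hsumY)
    rwa [one_div, inv_mul_le_iff₀ hΩ] at this

/-- The permutation of two copies of `ι` that exchanges the copies of `i` whenever `σ i`. -/
def copySwap {ι : Type*} (σ : ι → Bool) : Equiv.Perm (ι ⊕ ι) :=
  Function.Involutive.toPerm
    (Sum.elim (fun i => if σ i then Sum.inr i else Sum.inl i)
      fun i => if σ i then Sum.inl i else Sum.inr i)
    (by rintro (i | i) <;> cases h : σ i <;> simp [h])

theorem copySwap_inl {ι : Type*} (σ : ι → Bool) (i : ι) :
    copySwap σ (Sum.inl i) = if σ i then Sum.inr i else Sum.inl i := rfl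

theorem copySwap_inr {ι : Type*} (σ : ι → Bool) (i : ι) :
    copySwap σ (Sum.inr i) = if σ i then Sum.inl i else Sum.inr i := rfl

/-- The exchanges of different indices are independent, so the average factors into two-point
averages, each at most `M`. -/
theorem sum_exp_copySwap_le {ι : Type*} [Fintype ι] [DecidableEq ι] {K θ M : ℝ}
    (c : ι ⊕ ι → ℝ)
    (hM : ∀ i, Real.exp (θ * (c (.inr i) - K * c (.inl i))) +
      Real.exp (θ * (c (.inl i) - K * c (.inr i))) ≤ 2 * M) :
    ∑ σ : ι → Bool, Real.exp (θ * ∑ i, (c (copySwap σ (.inr i)) - K * c (copySwap σ (.inl i)))) ≤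
      Fintype.card (ι → Bool) * M ^ Fintype.card ι := by
  let u : ι → Bool → ℝ := fun i b =>
    if b then Real.exp (θ * (c (.inl i) - K * c (.inr i)))
    else Real.exp (θ * (c (.inr i) - K * c (.inl i)))
  have hu : ∀ σ : ι → Bool, Real.exp (θ * ∑ i, (c (copySwap σ (.inr i)) -
      K * c (copySwap σ (.inl i)))) = ∏ i, u i (σ i) := by
    intro σ
    rw [Finset.mul_sum, Real.exp_sum]
    refine Finset.prod_congr rfl fun i _ => ?_
    rw [copySwap_inl, copySwap_inr]
    cases h : σ i <;> simp [u]
  simp_rw [hu]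
  have := Finset.prod_univ_sum (fun _ : ι => (Finset.univ : Finset Bool)) u
  rw [Fintype.piFinset_univ] at this
  rw [← this]
  calc ∏ i, ∑ b, u i b ≤ ∏ _i : ι, 2 * M := by
        refine Finset.prod_le_prod (fun i _ => Finset.sum_nonneg fun b _ => ?_) fun i _ => ?_
        · simp only [u]; split_ifs <;> positivity
        · rw [Fintype.sum_bool]
          simp only [u, if_true, Bool.false_eq_true, if_false]
          linarith [hM i]
    _ = _ := by simp [mul_pow]

section Sauer

variable {X : Type u}

open Classical in
/-- The labellings of the points `z` that are realized by `H`. -/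
noncomputable def patterns {ι : Type*} [Fintype ι] (H : Set (X → Bool)) (z : ι → X) :
    Finset (ι → Bool) :=
  Finset.univ.filter fun b => ∃ h ∈ H, h ∘ z = b

theorem comp_mem_patterns {ι : Type*} [Fintype ι] {H : Set (X → Bool)} {h : X → Bool}
    (hh : h ∈ H) (z : ι → X) : h ∘ z ∈ patterns H z := by
  simp only [patterns, Finset.mem_filter, Finset.mem_univ, true_and]
  exact ⟨h, hh, rfl⟩

/-- The Sauer-Shelah bound for the number of realized labellings. -/
theorem HasVCDim.card_patterns_le {ι : Type*} [Fintype ι] {H : Set (X → Bool)} {d : ℕ}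
    (hd : HasVCDim H d) (z : ι → X) :
    (patterns H z).card ≤ (Fintype.card ι + 1) ^ d := by
  classical
  let supp : (ι → Bool) → Finset ι := fun b => Finset.univ.filter fun i => b i = true
  have hinj : Function.Injective supp := by
    intro b b' h
    funext i
    have : i ∈ supp b ↔ i ∈ supp b' := by rw [h]
    simpa [supp, ← Bool.eq_iff_iff] using this
  set F := (patterns H z).image supp with hF
  have hcard : (patterns H z).card = F.card := (Finset.card_image_of_injective _ hinj).symm
  have hvc : F.vcDim ≤ d := by
    refine Finset.sup_le fun t ht => ?_
    rw [Finset.mem_shatterer] at ht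
    have hreal : ∀ s ⊆ t, ∃ h ∈ H, ∀ i ∈ t, h (z i) = true ↔ i ∈ s := by
      intro s hs
      obtain ⟨u, hu, hus⟩ := ht hs
      obtain ⟨b, hb, rfl⟩ := Finset.mem_image.1 hu
      obtain ⟨h, hh, rfl⟩ := (Finset.mem_filter.1 hb).2
      refine ⟨h, hh, fun i hi => ?_⟩
      rw [← hus]
      simp [supp, hi]
    -- A repeated sample point always gets the same label, so shattered indices carry distinct
    -- points.
    have hzinj : Set.InjOn z t := by
      intro i hi j hj hij
      obtain ⟨h, -, hh⟩ := hreal {i} (by simpa using hi)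
      have h1 := (hh i hi).2 (by simp)
      rw [hij] at h1
      simpa [eq_comm] using (hh j hj).1 h1
    rw [← Finset.card_image_of_injOn hzinj]
    refine hd.2 ⟨_, rfl, fun b => ?_⟩
    obtain ⟨h, hH, hh⟩ := hreal (t.filter fun i => b (z i) = true) (Finset.filter_subset _ _)
    refine ⟨h, hH, fun x hx => ?_⟩
    obtain ⟨i, hi, rfl⟩ := Finset.mem_image.1 hx
    have := hh i hi
    simp only [Finset.mem_filter, hi, true_and] at this
    exact Bool.eq_iff_iff.2 this
  rw [hcard]
  calc F.card ≤ F.shatterer.card := Finset.card_le_card_shatterer F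
    _ ≤ ∑ k ∈ Finset.Iic F.vcDim, (Fintype.card ι).choose k := Finset.card_shatterer_le_sum_vcDim
    _ ≤ ∑ k ∈ Finset.range (d + 1), (Fintype.card ι).choose k := by
        refine Finset.sum_le_sum_of_subset fun k hk => ?_
        simp only [Finset.mem_Iic, Finset.mem_range] at hk ⊢
        omega
    -- The factor `d.choose k` ≥ 1 is inserted to make the sum binomial.
    _ ≤ ∑ k ∈ Finset.range (d + 1), Fintype.card ι ^ k * 1 ^ (d - k) * d.choose k := by
        refine Finset.sum_le_sum fun k hk => ?_
        rw [one_pow, mul_one]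
        have : 0 < d.choose k := Nat.choose_pos (by simpa [Nat.lt_succ_iff] using hk)
        exact (Nat.choose_le_pow _ _).trans (Nat.le_mul_of_pos_right _ this)
    _ = _ := (add_pow _ _ _).symm

end Sauer

section Symmetrization

variable {X : Type u} [MeasurableSpace X]

theorem measurePreserving_comp_equiv {ι κ : Type*} [Fintype ι] [Fintype κ] (μ : Measure X)
    [IsProbabilityMeasure μ] (e : ι ≃ κ) :
    MeasurePreserving (fun z : κ → X => z ∘ e) (Measure.pi fun _ => μ)
      (Measure.pi fun _ => μ) := by
  have := measurePreserving_piCongrLeft (α := fun _ : ι => X) (fun _ => μ) e.symm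
  convert this using 1
  funext z i
  have h := Equiv.piCongrLeft_apply_apply (fun _ : ι => X) e.symm z (e i)
  rw [MeasurableEquiv.coe_piCongrLeft]
  simpa using h.symm

theorem EmpiricallyMeasurable.nullMeasurableSet {H : Set (X → Bool)}
    (hE : EmpiricallyMeasurable H) (μ : ProbabilityMeasure X) {n : ℕ}
    (b : Fin n ⊕ Fin n → Bool) :
    NullMeasurableSet {z : Fin n ⊕ Fin n → X | ∃ h ∈ H, h ∘ z = b}
      (Measure.pi fun _ => (μ : Measure X)) := by
  have h1 := hE (n + n) (b ∘ finSumFinEquiv.symm) μ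
  have h2 := h1.preimage (measurePreserving_comp_equiv (μ : Measure X)
    (finSumFinEquiv (m := n) (n := n)).symm).quasiMeasurePreserving
  convert h2 using 1
  ext z
  refine exists_congr fun h => and_congr_right fun _ => ?_
  rw [funext_iff]
  exact (finSumFinEquiv (m := n) (n := n)).symm.forall_congr_right.symm

/-- Symmetrization: a bound for all averages over exchanges of a double sample bounds the supremum
over `H` of the mean over the second half of the double sample. -/
theorem EmpiricallyMeasurable.exists_symmetrized_bound {H : Set (X → Bool)}
    (hE : EmpiricallyMeasurable H) (μ : ProbabilityMeasure X) {t : X → Bool} (ht : Measurable t)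
    {n : ℕ} (V : (Fin n ⊕ Fin n → Bool) → (Fin n ⊕ Fin n → Bool) → ℝ≥0∞) {B : ℝ≥0∞}
    (hB : ∀ z : Fin n ⊕ Fin n → X, ∃ W : (Fin n → Bool) → ℝ≥0∞,
      (∀ σ, ∀ h ∈ H, V (h ∘ z ∘ copySwap σ) (t ∘ z ∘ copySwap σ) ≤ W σ) ∧
      ∑ σ, W σ ≤ Fintype.card (Fin n → Bool) * B) :
    ∃ g : (Fin n → X) → ℝ≥0∞, Measurable g ∧
      (∀ S, ∀ h ∈ H, ∫⁻ S', V (h ∘ Sum.elim S S') (t ∘ Sum.elim S S') ∂iidLaw μ n ≤ g S) ∧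
      ∫⁻ S, g S ∂iidLaw μ n ≤ B := by
  set ν : Measure (Fin n ⊕ Fin n → X) := Measure.pi fun _ => (μ : Measure X) with hν
  set E : (Fin n ⊕ Fin n → Bool) → Set (Fin n ⊕ Fin n → X) := fun b => {z | ∃ h ∈ H, h ∘ z = b}
  have hEn : ∀ b, NullMeasurableSet (E b) ν := fun b => hE.nullMeasurableSet μ b
  -- Measurable hulls of the pattern events give a measurable majorant valid everywhere; null
  -- measurability makes it almost everywhere the true supremum.
  set G : (Fin n ⊕ Fin n → X) → ℝ≥0∞ := fun z =>
    ⨆ b, (toMeasurable ν (E b)).indicator (fun z => V b (t ∘ z)) z with hG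
  have hGm : Measurable G := by
    refine Measurable.iSup fun b => Measurable.indicator ?_ (measurableSet_toMeasurable _ _)
    refine (Measurable.of_discrete (f := V b)).comp ?_
    exact measurable_pi_lambda _ fun i => ht.comp (measurable_pi_apply i)
  have hGV : ∀ z, ∀ h ∈ H, V (h ∘ z) (t ∘ z) ≤ G z := by
    intro z h hh
    refine le_iSup_of_le (h ∘ z) ?_
    rw [Set.indicator_of_mem (subset_toMeasurable ν (E (h ∘ z)) ⟨h, hh, rfl⟩)]
  have hGae : ∀ᵐ z ∂ν, ∀ w, (∀ h ∈ H, V (h ∘ z) (t ∘ z) ≤ w) → G z ≤ w := by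
    have : ∀ᵐ z ∂ν, ∀ b, z ∈ toMeasurable ν (E b) ↔ z ∈ E b := by
      rw [ae_all_iff]
      intro b
      exact (hEn b).toMeasurable_ae_eq.mem_iff
    filter_upwards [this] with z hz w hw
    refine iSup_le fun b => ?_
    by_cases hb : z ∈ E b
    · rw [Set.indicator_of_mem ((hz b).2 hb)]
      obtain ⟨h, hh, rfl⟩ := hb
      exact hw h hh
    · rw [Set.indicator_of_notMem (mt (hz b).1 hb)]
      exact zero_le
  have hswap : ∀ σ : Fin n → Bool, MeasurePreserving
      (fun z : Fin n ⊕ Fin n → X => z ∘ copySwap σ) ν ν :=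
    fun σ => measurePreserving_comp_equiv (μ : Measure X) (copySwap σ)
  have hint : ∫⁻ z, G z ∂ν ≤ B := by
    have h1 : (Fintype.card (Fin n → Bool) : ℝ≥0∞) * ∫⁻ z, G z ∂ν =
        ∫⁻ z, ∑ σ : Fin n → Bool, G (z ∘ copySwap σ) ∂ν := by
      rw [lintegral_finsetSum (f := fun σ : Fin n → Bool => fun z => G (z ∘ copySwap σ)) _
        fun σ _ => hGm.comp (hswap σ).measurable]
      have : ∀ σ : Fin n → Bool, ∫⁻ z, G (z ∘ copySwap σ) ∂ν = ∫⁻ z, G z ∂ν :=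
        fun σ => (hswap σ).lintegral_comp hGm
      simp [this]
    have h2 : ∫⁻ z, ∑ σ : Fin n → Bool, G (z ∘ copySwap σ) ∂ν ≤
        ∫⁻ _, Fintype.card (Fin n → Bool) * B ∂ν := by
      refine lintegral_mono_ae ?_
      have : ∀ᵐ z ∂ν, ∀ σ : Fin n → Bool, ∀ w,
          (∀ h ∈ H, V (h ∘ z ∘ copySwap σ) (t ∘ z ∘ copySwap σ) ≤ w) → G (z ∘ copySwap σ) ≤ w := by
        rw [ae_all_iff]
        exact fun σ => (hswap σ).quasiMeasurePreserving.ae hGae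
      filter_upwards [this] with z hz
      obtain ⟨W, hW, hWB⟩ := hB z
      exact (Finset.sum_le_sum fun σ _ => hz σ (W σ) (hW σ)).trans hWB
    rw [← h1, lintegral_const, measure_univ, mul_one] at h2
    exact (ENNReal.mul_le_mul_iff_right (by simp) (by simp)).1 h2
  have hsum : MeasurePreserving (fun p : (Fin n → X) × (Fin n → X) => Sum.elim p.1 p.2)
      ((iidLaw μ n).prod (iidLaw μ n)) ν := by
    convert measurePreserving_sumPiEquivProdPi_symm (X := fun _ : Fin n ⊕ Fin n => X)
      fun _ => (μ : Measure X) using 1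
    · funext p k
      cases k <;> rfl
    · rfl
  have : SFinite (iidLaw μ n) := by unfold iidLaw; infer_instance
  refine ⟨fun S => ∫⁻ S', G (Sum.elim S S') ∂iidLaw μ n,
    (hGm.comp hsum.measurable).lintegral_prod_right', fun S h hh => ?_, ?_⟩
  · exact lintegral_mono fun S' => hGV _ h hh
  · rw [← lintegral_prod (fun p : (Fin n → X) × (Fin n → X) => G (Sum.elim p.1 p.2))
      (hGm.comp hsum.measurable).aemeasurable, hsum.lintegral_comp hGm]
    exact hint

end Symmetrization

end NeymanPearson

/-! ### Deviation bounds and empirical risk minimization -/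

namespace NeymanPearson

variable {X : Type u} [MeasurableSpace X]

theorem ofReal_integral_le {Ω : Type*} [MeasurableSpace Ω] {P : Measure Ω} {f : Ω → ℝ}
    (hf : Integrable f P) : ENNReal.ofReal (∫ ω, f ω ∂P) ≤ ∫⁻ ω, ENNReal.ofReal (f ω) ∂P := by
  have h1 : ∫ ω, f ω ∂P ≤ ∫ ω, max (f ω) 0 ∂P :=
    integral_mono hf hf.pos_part fun ω => le_max_left _ _
  refine (ENNReal.ofReal_le_ofReal h1).trans (le_of_eq ?_)
  rw [ofReal_integral_eq_lintegral_ofReal hf.pos_part (ae_of_all _ fun ω => le_max_right _ _)]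
  simp

theorem integrable_bool_comp (μ : ProbabilityMeasure X) {f : Bool → Bool → ℝ}
    (hf : ∀ a b, |f a b| ≤ 1) {h t : X → Bool} (hh : Measurable h) (ht : Measurable t) :
    Integrable (fun x => f (h x) (t x)) (μ : Measure X) := by
  have hm : Measurable fun x => f (h x) (t x) :=
    (Measurable.of_discrete (f := fun p : Bool × Bool => f p.1 p.2)).comp (hh.prodMk ht)
  exact Integrable.of_bound hm.aestronglyMeasurable 1 (ae_of_all _ fun x => hf _ _)

/-- Deviation of the mean of `f (h x) (t x)` from `K` times its empirical mean, uniformly in the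
members `h` of a class of finite VC dimension. -/
theorem EmpiricallyMeasurable.exists_deviation_bound {H : Set (X → Bool)}
    (hE : EmpiricallyMeasurable H) (hmeas : ∀ h ∈ H, Measurable h) {d : ℕ} (hd : HasVCDim H d)
    (μ : ProbabilityMeasure X) {t : X → Bool} (ht : Measurable t) {n : ℕ} (hn : 0 < n)
    {f : Bool → Bool → ℝ} (hf : ∀ a b, |f a b| ≤ 1) {K θ M : ℝ} (hθ : 0 < θ) (hM0 : 0 ≤ M)
    (hM : ∀ a b a' b', Real.exp (θ * (f a b - K * f a' b')) +
      Real.exp (θ * (f a' b' - K * f a b)) ≤ 2 * M) :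
    ∃ g : (Fin n → X) → ℝ≥0∞, Measurable g ∧
      (∀ S, ∀ h ∈ H, ENNReal.ofReal (∫ x, f (h x) (t x) ∂(μ : Measure X) -
        K * ((∑ i, f (h (S i)) (t (S i))) / n)) ≤ g S) ∧
      ∫⁻ S, g S ∂iidLaw μ n ≤
        ENNReal.ofReal (Real.log (1 + (2 * n + 1) ^ d * M ^ n) / (n * θ)) := by
  have hn' : (0 : ℝ) < n := by exact_mod_cast hn
  let c : (Fin n ⊕ Fin n → Bool) → (Fin n ⊕ Fin n → Bool) → Fin n ⊕ Fin n → ℝ :=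
    fun b τ k => f (b k) (τ k)
  obtain ⟨g, hg, hgS, hgB⟩ := hE.exists_symmetrized_bound μ ht (n := n)
    (fun b τ => ENNReal.ofReal ((∑ i, (c b τ (.inr i) - K * c b τ (.inl i))) / n))
    (B := ENNReal.ofReal (Real.log (1 + (2 * n + 1) ^ d * M ^ n) / (n * θ))) (by
      intro z
      obtain ⟨W, hW0, hWv, hWs⟩ := exists_sum_le_log_of_sum_exp_le (Ω := Fin n → Bool)
        (patterns H z) (fun p σ => (∑ i, (c p (t ∘ z) (copySwap σ (.inr i)) -
          K * c p (t ∘ z) (copySwap σ (.inl i)))) / n) (c := n * θ) (M := M ^ n)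
        (by positivity) (by
          intro p _
          have := sum_exp_copySwap_le (K := K) (θ := θ) (M := M) (c p (t ∘ z))
            fun i => hM _ _ _ _
          rw [Fintype.card_fin] at this
          refine le_trans (le_of_eq (Finset.sum_congr rfl fun σ _ => ?_)) this
          congr 1
          field_simp)
      refine ⟨fun σ => ENNReal.ofReal (W σ), fun σ h hh => ENNReal.ofReal_le_ofReal ?_, ?_⟩
      · exact hWv _ (comp_mem_patterns hh z) σ
      · rw [← ENNReal.ofReal_sum_of_nonneg fun σ _ => hW0 σ, ← ENNReal.ofReal_natCast,
          ← ENNReal.ofReal_mul (by positivity)]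
        refine ENNReal.ofReal_le_ofReal (hWs.trans ?_)
        have hcard : ((patterns H z).card : ℝ) ≤ (2 * n + 1) ^ d := by
          have := hd.card_patterns_le z
          rw [Fintype.card_sum, Fintype.card_fin, ← two_mul] at this
          exact_mod_cast this
        gcongr)
  refine ⟨g, hg, fun S h hh => le_trans ?_ (hgS S h hh), hgB⟩
  have hF := integrable_bool_comp μ hf (hmeas h hh) ht
  have hev : ∀ i : Fin n, MeasurePreserving (fun S' : Fin n → X => S' i) (iidLaw μ n)
      (μ : Measure X) := fun i => measurePreserving_eval (fun _ : Fin n => (μ : Measure X)) i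
  have : IsProbabilityMeasure (iidLaw μ n) := by unfold iidLaw; infer_instance
  have hint : ∀ i : Fin n, Integrable (fun S' : Fin n → X =>
      f (h (S' i)) (t (S' i)) - K * f (h (S i)) (t (S i))) (iidLaw μ n) := fun i =>
    ((hev i).integrable_comp_of_integrable hF).sub (integrable_const _)
  have hval : ∀ i : Fin n, ∫ S', (f (h (S' i)) (t (S' i)) - K * f (h (S i)) (t (S i)))
      ∂iidLaw μ n = ∫ x, f (h x) (t x) ∂(μ : Measure X) - K * f (h (S i)) (t (S i)) := by
    intro i
    have hFi : Integrable (fun S' : Fin n → X => f (h (S' i)) (t (S' i))) (iidLaw μ n) :=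
      (hev i).integrable_comp_of_integrable hF
    rw [integral_sub hFi (integrable_const _), integral_const, probReal_univ, one_smul]
    congr 1
    exact integral_comp_eval (μ := fun _ : Fin n => (μ : Measure X)) hF.aestronglyMeasurable
  -- Integrating out the second half turns its empirical mean into the true mean; the positive part
  -- only increases under this integral.
  have hmean : ∫ S', (∑ i, (f (h (S' i)) (t (S' i)) - K * f (h (S i)) (t (S i)))) / n
      ∂iidLaw μ n = ∫ x, f (h x) (t x) ∂(μ : Measure X) -
        K * ((∑ i, f (h (S i)) (t (S i))) / n) := by
    rw [integral_div, integral_finsetSum _ fun i _ => hint i]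
    simp_rw [hval]
    rw [Finset.sum_sub_distrib, ← Finset.mul_sum]
    simp only [Finset.sum_const, Finset.card_univ, Fintype.card_fin, nsmul_eq_mul]
    field_simp
  rw [← hmean]
  exact ofReal_integral_le ((integrable_finsetSum _ fun i _ => hint i).div_const _)

/-- The loss difference of two hypotheses on a point of the alternative, in terms of their
labels. -/
noncomputable def lossDiff (a b : Bool) : ℝ :=
  (if a = false then 1 else 0) - if b = false then 1 else 0

theorem abs_lossDiff_le (a b : Bool) : |lossDiff a b| ≤ 1 := by
  cases a <;> cases b <;> simp [lossDiff]

/-- The positive part of the loss difference. -/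
noncomputable def lossExcess (a b : Bool) : ℝ := if a = false ∧ b = true then 1 else 0

theorem abs_lossExcess_le (a b : Bool) : |lossExcess a b| ≤ 1 := by
  cases a <;> cases b <;> simp [lossExcess]

theorem risk₁_eq_integral (μ : ProbabilityMeasure X) {h : X → Bool} (hh : Measurable h) :
    risk₁ μ h = ∫ x, (if h x = false then 1 else 0 : ℝ) ∂(μ : Measure X) := by
  have hs : MeasurableSet {x | h x = false} := hh (measurableSet_singleton false)
  rw [risk₁, ← integral_indicator_one hs]
  refine integral_congr_ae (ae_of_all _ fun x => ?_)
  by_cases hx : h x = false <;> simp [Set.indicator, hx]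

theorem integral_lossDiff (μ : ProbabilityMeasure X) {h t : X → Bool} (hh : Measurable h)
    (ht : Measurable t) :
    ∫ x, lossDiff (h x) (t x) ∂(μ : Measure X) = risk₁ μ h - risk₁ μ t := by
  have hi : ∀ {h : X → Bool}, Measurable h →
      Integrable (fun x => (if h x = false then 1 else 0 : ℝ)) (μ : Measure X) := fun hh =>
    integrable_bool_comp μ (f := fun a _ => if a = false then 1 else 0)
      (fun a _ => by cases a <;> simp) hh hh
  rw [risk₁_eq_integral μ hh, risk₁_eq_integral μ ht, ← integral_sub (hi hh) (hi ht)]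
  rfl

theorem sub_risk₁_le_integral_lossExcess (μ : ProbabilityMeasure X) {h t : X → Bool}
    (hh : Measurable h) (ht : Measurable t) :
    risk₁ μ h - risk₁ μ t ≤ ∫ x, lossExcess (h x) (t x) ∂(μ : Measure X) := by
  rw [← integral_lossDiff μ hh ht]
  refine integral_mono (integrable_bool_comp μ abs_lossDiff_le hh ht)
    (integrable_bool_comp μ abs_lossExcess_le hh ht) fun x => ?_
  cases h x <;> cases t x <;> simp [lossDiff, lossExcess]

/-- An empirical risk minimizer, which selects as many sample points as possible. -/
theorem exists_empirical_minimizer {H : Set (X → Bool)} {α : ℝ} {μ₀ : ProbabilityMeasure X}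
    (hne : (level H α μ₀).Nonempty) (n : ℕ) :
    ∃ A : ExactLearner H α μ₀ n, ∀ S, ∀ t ∈ level H α μ₀,
      (Finset.univ.filter fun i => t (S i) = true).card ≤
        (Finset.univ.filter fun i => (A S : X → Bool) (S i) = true).card := by
  have : ∀ S : Fin n → X, ∃ h : level H α μ₀, ∀ t ∈ level H α μ₀,
      (Finset.univ.filter fun i => t (S i) = true).card ≤
        (Finset.univ.filter fun i => (h : X → Bool) (S i) = true).card := by
    intro S
    set N : Set ℕ :=
      (fun t : X → Bool => (Finset.univ.filter fun i => t (S i) = true).card) '' level H α μ₀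
    have hbdd : BddAbove N := by
      refine ⟨n, ?_⟩
      rintro _ ⟨t, -, rfl⟩
      exact (Finset.card_filter_le _ _).trans (by simp)
    obtain ⟨h, hh, hhN⟩ := Nat.sSup_mem (hne.image _) hbdd
    exact ⟨⟨h, hh⟩, fun t ht => (le_csSup hbdd ⟨t, ht, rfl⟩).trans hhN.ge⟩
  choose A hA using this
  exact ⟨A, hA⟩

theorem minimaxRisk_le {H : Set (X → Bool)} {α : ℝ} {μ₀ : ProbabilityMeasure X} {n : ℕ}
    (A : ExactLearner H α μ₀ n) {B ε : ℝ} (hB : 0 ≤ B) (hε : 0 < ε)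
    (h : ∀ μ₁ : ProbabilityMeasure X, ∀ t ∈ level H α μ₀, ∃ g : (Fin n → X) → ℝ≥0∞,
      Measurable g ∧ (∀ S, ENNReal.ofReal (risk₁ μ₁ (A S) - risk₁ μ₁ t) ≤ g S) ∧
        ∫⁻ S, g S ∂iidLaw μ₁ n ≤ ENNReal.ofReal B) :
    minimaxRisk H α μ₀ n ≤ ENNReal.ofReal (B + ε) := by
  refine iInf_le_of_le A (iSup₂_le fun μ₁ hμ₁ => ?_)
  have hne : (level H α μ₀).Nonempty := hμ₁
  -- The infimum need not be attained; a near-minimizer costs an extra `ε`.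
  obtain ⟨_, ⟨t, ht, rfl⟩, htε⟩ := exists_lt_of_csInf_lt (hne.image (risk₁ μ₁))
    (lt_add_of_pos_right (sInf (risk₁ μ₁ '' level H α μ₀)) hε)
  obtain ⟨g, hg, hgS, hgB⟩ := h μ₁ t ht
  have : IsProbabilityMeasure (iidLaw μ₁ n) := by unfold iidLaw; infer_instance
  calc _ ≤ ∫⁻ S, (g S + ENNReal.ofReal ε) ∂iidLaw μ₁ n := by
        refine iInf₂_le_of_le _ (hg.add_const _) (iInf_le _ fun S => ?_)
        refine le_trans ?_ (add_le_add_left (hgS S) _)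
        beta_reduce
        rw [excessRisk, ENNReal.ofReal_max, ENNReal.ofReal_zero, max_eq_right zero_le]
        refine le_trans (ENNReal.ofReal_le_ofReal ?_) ENNReal.ofReal_add_le
        linarith
    _ = ∫⁻ S, g S ∂iidLaw μ₁ n + ENNReal.ofReal ε := by
        rw [lintegral_add_left hg, lintegral_const, measure_univ, mul_one]
    _ ≤ ENNReal.ofReal (B + ε) := by
        rw [ENNReal.ofReal_add hB hε.le]
        gcongr

theorem log_one_add_pow_le {n d : ℕ} (hn : 2 ≤ n) (hd : 1 ≤ d) :
    Real.log (1 + (2 * n + 1) ^ d) ≤ 3 * (d * Real.log n) := by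
  have hn' : (2 : ℝ) ≤ n := by exact_mod_cast hn
  have h1 : (1 : ℝ) + (2 * n + 1) ^ d ≤ (n ^ 3) ^ d := by
    calc (1 : ℝ) + (2 * n + 1) ^ d ≤ 1 ^ d + (2 * n + 1) ^ d := by simp
      _ ≤ (1 + (2 * n + 1)) ^ d := pow_add_pow_le zero_le_one (by positivity) (by omega)
      _ ≤ (n ^ 3) ^ d := by
        gcongr
        nlinarith [mul_nonneg (sub_nonneg.2 hn') (sub_nonneg.2 hn'), mul_nonneg
          (mul_nonneg (sub_nonneg.2 hn') (sub_nonneg.2 hn')) (sub_nonneg.2 hn')]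
  refine (Real.log_le_log (by positivity) h1).trans (le_of_eq ?_)
  rw [Real.log_pow, Real.log_pow]
  push_cast
  ring

/-- Empirical risk minimization attains the slow rate. -/
theorem minimaxRisk_le_sqrt {H : Set (X → Bool)} (hmeas : ∀ h ∈ H, Measurable h) {d : ℕ}
    (hd : HasVCDim H d) (hd1 : 1 ≤ d) (hE : EmpiricallyMeasurable H) {α : ℝ}
    {μ₀ : ProbabilityMeasure X} (hne : (level H α μ₀).Nonempty) {n : ℕ} (hn : 2 ≤ n) :
    minimaxRisk H α μ₀ n ≤ ENNReal.ofReal (6 * √((d : ℝ) / n * Real.log n)) := by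
  obtain ⟨A, hA⟩ := exists_empirical_minimizer hne n
  have hn' : (2 : ℝ) ≤ n := by exact_mod_cast hn
  have hd' : (1 : ℝ) ≤ d := by exact_mod_cast hd1
  have hlog : 0 < Real.log n := Real.log_pos (by linarith)
  -- This θ balances the entropy term 3d log n against the moment term 2nθ².
  set θ := √((d : ℝ) / n * Real.log n) with hθdef
  have hθ : 0 < θ := Real.sqrt_pos.2 (by positivity)
  have hθ2 : θ ^ 2 = (d : ℝ) / n * Real.log n := Real.sq_sqrt (by positivity)
  have hbound : Real.log (1 + (2 * n + 1) ^ d * Real.exp (2 * θ ^ 2) ^ n) / (n * θ) ≤ 5 * θ := by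
    rw [div_le_iff₀ (by positivity)]
    have hexp : 1 ≤ Real.exp (2 * θ ^ 2) ^ n :=
      one_le_pow₀ (Real.one_le_exp (by positivity))
    calc Real.log (1 + (2 * n + 1) ^ d * Real.exp (2 * θ ^ 2) ^ n)
        ≤ Real.log ((1 + (2 * n + 1) ^ d) * Real.exp (2 * θ ^ 2) ^ n) := by
          apply Real.log_le_log (by positivity)
          rw [add_mul, one_mul]
          gcongr
      _ = Real.log (1 + (2 * n + 1) ^ d) + n * (2 * θ ^ 2) := by
          rw [Real.log_mul (by positivity) (by positivity), Real.log_pow, Real.log_exp]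
      _ ≤ 3 * (d * Real.log n) + n * (2 * θ ^ 2) := by
          gcongr
          exact log_one_add_pow_le hn hd1
      _ = 5 * (n * θ ^ 2) := by
          rw [hθ2]; field_simp; ring
      _ = 5 * θ * (n * θ) := by ring
  have hfin := minimaxRisk_le A (B := 5 * θ) (ε := θ) (by positivity) hθ ?_
  · convert hfin using 2; ring
  intro μ₁ t ht
  have htm := hmeas t ht.1
  obtain ⟨g, hg, hgS, hgB⟩ := hE.exists_deviation_bound hmeas hd μ₁ htm (by omega : 0 < n)
    abs_lossDiff_le (K := 1) hθ (Real.exp_pos (2 * θ ^ 2)).le (by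
      intro a b a' b'
      have h1 := abs_le.1 (abs_lossDiff_le a b)
      have h2 := abs_le.1 (abs_lossDiff_le a' b')
      set u := lossDiff a b
      set v := lossDiff a' b'
      have h3 : Real.cosh (θ * (u - v)) ≤ Real.exp (2 * θ ^ 2) := by
        refine (Real.cosh_le_exp_half_sq _).trans (Real.exp_le_exp.2 ?_)
        have : (u - v) ^ 2 ≤ 2 ^ 2 := sq_le_sq' (by linarith) (by linarith)
        rw [mul_pow]
        nlinarith [mul_le_mul_of_nonneg_left this (sq_nonneg θ)]
      rw [Real.cosh_eq] at h3
      have h4 : θ * (v - 1 * u) = -(θ * (u - v)) := by ring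
      rw [h4, one_mul]
      linarith)
  refine ⟨g, hg, fun S => ?_, hgB.trans (ENNReal.ofReal_le_ofReal hbound)⟩
  refine le_trans (ENNReal.ofReal_le_ofReal ?_) (hgS S (A S) (A S).2.1)
  rw [integral_lossDiff μ₁ (hmeas _ (A S).2.1) htm]
  have hcount : ∀ h : X → Bool, (∑ i, if h (S i) = false then (1 : ℝ) else 0) =
      n - (Finset.univ.filter fun i => h (S i) = true).card := by
    intro h
    have := Finset.card_filter_add_card_filter_not (s := (Finset.univ : Finset (Fin n)))
      (fun i => h (S i) = true)
    simp only [Finset.card_univ, Fintype.card_fin, Bool.not_eq_true] at this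
    rw [Finset.sum_boole, eq_sub_iff_add_eq']
    exact_mod_cast this
  have hsum : ∑ i, lossDiff ((A S : X → Bool) (S i)) (t (S i)) ≤ 0 := by
    simp only [lossDiff]
    rw [Finset.sum_sub_distrib, hcount, hcount]
    have : ((Finset.univ.filter fun i => t (S i) = true).card : ℝ) ≤
        (Finset.univ.filter fun i => (A S : X → Bool) (S i) = true).card := by
      exact_mod_cast hA S t ht
    linarith
  have := div_nonpos_of_nonpos_of_nonneg hsum (by positivity : (0 : ℝ) ≤ n)
  linarith

/-- Empirical risk minimization attains the fast rate over nested hypotheses. -/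
theorem minimaxRisk_le_div {H : Set (X → Bool)} (hmeas : ∀ h ∈ H, Measurable h) {d : ℕ}
    (hd : HasVCDim H d) (hd1 : 1 ≤ d) (hE : EmpiricallyMeasurable H) {α : ℝ}
    {μ₀ : ProbabilityMeasure X} (hne : (level H α μ₀).Nonempty)
    (hchain : ∀ h ∈ level H α μ₀, ∀ h' ∈ level H α μ₀,
      (∀ x, h x = true → h' x = true) ∨ (∀ x, h' x = true → h x = true))
    {n : ℕ} (hn : 2 ≤ n) :
    minimaxRisk H α μ₀ n ≤ ENNReal.ofReal (10 * ((d : ℝ) / n * Real.log n)) := by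
  obtain ⟨A, hA⟩ := exists_empirical_minimizer hne n
  have hn' : (2 : ℝ) ≤ n := by exact_mod_cast hn
  have hd' : (1 : ℝ) ≤ d := by exact_mod_cast hd1
  have hlog : 0 < Real.log n := Real.log_pos (by linarith)
  set L := (d : ℝ) / n * Real.log n with hL
  have hL0 : 0 < L := by positivity
  -- For values in {0, 1} and K = 2 the worst nonzero case is exp θ + exp (-2θ) = 3/2 + 4/9 ≤ 2, so
  -- M = 1 works and no term grows with n.
  set θ := Real.log (3 / 2) with hθdef
  have hθ3 : 1 / 3 ≤ θ := by
    have := Real.one_sub_inv_le_log_of_pos (by norm_num : (0 : ℝ) < 3 / 2)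
    norm_num at this ⊢
    exact this
  have hθ : 0 < θ := by linarith
  have hexpθ : Real.exp θ = 3 / 2 := Real.exp_log (by norm_num)
  have hbound : Real.log (1 + (2 * n + 1) ^ d * 1 ^ n) / (n * θ) ≤ 9 * L := by
    rw [one_pow, mul_one, div_le_iff₀ (by positivity)]
    calc Real.log (1 + (2 * n + 1) ^ d) ≤ 3 * (d * Real.log n) := log_one_add_pow_le hn hd1
      _ = 9 * L * (n * (1 / 3)) := by rw [hL]; field_simp; norm_num
      _ ≤ 9 * L * (n * θ) := by gcongr
  have hfin := minimaxRisk_le A (B := 9 * L) (ε := L) (by positivity) hL0 ?_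
  · convert hfin using 2; ring
  intro μ₁ t ht
  have htm := hmeas t ht.1
  obtain ⟨g, hg, hgS, hgB⟩ := hE.exists_deviation_bound hmeas hd μ₁ htm (by omega : 0 < n)
    abs_lossExcess_le (K := 2) hθ zero_le_one (by
      have hcase : ∀ a b, lossExcess a b = 0 ∨ lossExcess a b = 1 := by
        intro a b; cases a <;> cases b <;> simp [lossExcess]
      have hexpn : Real.exp (-θ) = 2 / 3 := by rw [Real.exp_neg, hexpθ]; norm_num
      have hexp2 : Real.exp (-(θ * 2)) = 4 / 9 := by
        rw [show -(θ * 2) = -θ + -θ by ring, Real.exp_add, hexpn]; norm_num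
      have e1 : θ * (1 - 2) = -θ := by ring
      intro a b a' b'
      rcases hcase a b with h | h <;> rcases hcase a' b' with h' | h' <;> rw [h, h'] <;>
        simp [e1, hexpθ, hexpn, hexp2] <;> norm_num)
  refine ⟨g, hg, fun S => ?_, hgB.trans (ENNReal.ofReal_le_ofReal hbound)⟩
  refine le_trans (ENNReal.ofReal_le_ofReal ?_) (hgS S (A S) (A S).2.1)
  refine (sub_risk₁_le_integral_lossExcess μ₁ (hmeas _ (A S).2.1) htm).trans ?_
  -- If the minimizer lies below `t`, missing a sample point of `t` would make its count strictly
  -- smaller; if it lies above, it misses none.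
  have hzero : ∀ i, lossExcess ((A S : X → Bool) (S i)) (t (S i)) = 0 := by
    intro i
    unfold lossExcess
    rw [if_neg]
    rintro ⟨h1, h2⟩
    rcases hchain _ (A S).2 t ht with hs | hs
    · have hsub : (Finset.univ.filter fun i => (A S : X → Bool) (S i) = true) ⊂
          Finset.univ.filter fun i => t (S i) = true := by
        rw [Finset.ssubset_iff_of_subset
          fun j hj => by simpa using hs _ (by simpa using hj)]
        exact ⟨i, by simpa using h2, by simp [h1]⟩
      exact absurd (Finset.card_lt_card hsub) (not_lt.2 (hA S t ht))
    · simp [hs _ h2] at h1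
  simp [hzero]

/-- Without separation of three points, the hypotheses of small risk are nested. -/
theorem level_nested {H : Set (X → Bool)}
    (hH : ¬ SeparatesThreePoints H) {α : ℝ} (hα : α < 1 / 2) {μ₀ : ProbabilityMeasure X} :
    ∀ h ∈ level H α μ₀, ∀ h' ∈ level H α μ₀,
      (∀ x, h x = true → h' x = true) ∨ (∀ x, h' x = true → h x = true) := by
  intro h hh h' hh'
  by_contra hcon
  push Not at hcon
  obtain ⟨⟨x₁, h1, h1'⟩, x₂, h2', h2⟩ := hcon
  refine hH ?_
  obtain ⟨x₀, h0, h0'⟩ : ∃ x₀, h x₀ = false ∧ h' x₀ = false := by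
    by_contra hno
    push Not at hno
    have hun : {x | h x = true} ∪ {x | h' x = true} = Set.univ := by
      ext x
      by_cases hx : h x = false
      · simpa [hx] using hno x hx
      · simp [hx]
    have h3 := measureReal_union_le (μ := (μ₀ : Measure X)) {x | h x = true} {x | h' x = true}
    rw [hun, probReal_univ] at h3
    have h4 := hh.2
    have h5 := hh'.2
    unfold risk₀ at h4 h5
    linarith
  exact ⟨h, hh.1, h', hh'.1, x₀, x₁, x₂, ⟨h0, h0'⟩, h1, h2', by simpa using h2, by simpa using h1'⟩

theorem minimaxRisk_eq_zero {H : Set (X → Bool)} {α : ℝ} {μ₀ : ProbabilityMeasure X} (n : ℕ)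
    (hmax : AdmitsMaximal (level H α μ₀)) : minimaxRisk H α μ₀ n = 0 := by
  obtain ⟨h, hh, hsup⟩ := hmax
  refine le_antisymm (iInf_le_of_le (fun _ => ⟨h, hh⟩) (iSup₂_le fun μ₁ _ => ?_)) zero_le
  have : excessRisk H α μ₀ μ₁ h = 0 := by
    refine max_eq_left (sub_nonpos.2 (le_csInf ⟨_, h, hh, rfl⟩ ?_))
    rintro _ ⟨h', hh', rfl⟩
    refine measureReal_mono fun x hx => ?_
    have h1 : h x = false := hx
    change h' x = false
    by_contra hc
    have : h x = true := hsup h' hh' (by simpa using hc)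
    simp [h1] at this
  refine iInf₂_le_of_le (fun _ => 0) measurable_const (iInf_le_of_le (fun S => ?_) (by simp))
  simp [this]

end NeymanPearson

/-! ### Assembly of the rates -/

theorem theorem1 :
    ∃ c C : ℝ, 0 < c ∧ 0 < C ∧
      ∀ (X : Type u) [MeasurableSpace X] [MeasurableSingletonClass X]
        (H : Set (X → Bool)) (_ : ∀ h ∈ H, Measurable h)
        (d : ℕ) (_ : NeymanPearson.HasVCDim H d)
        (α : ℝ) (_ : 0 < α) (_ : α < 1 / 2),
        -- (i) three-points-separation: rate of order `√(d / n)`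
        (NeymanPearson.SeparatesThreePoints H →
          ∃ μ₀ : ProbabilityMeasure X, (NeymanPearson.level H α μ₀).Nonempty ∧
            ∀ n : ℕ, 2 * d ≤ n →
              ENNReal.ofReal (c * √((d : ℝ) / n)) ≤ NeymanPearson.minimaxRisk H α μ₀ n ∧
              (NeymanPearson.EmpiricallyMeasurable H →
                NeymanPearson.minimaxRisk H α μ₀ n ≤
                  ENNReal.ofReal (C * √((d : ℝ) / n * Real.log n)))) ∧
        -- (ii) no three-points-separation
        (¬ NeymanPearson.SeparatesThreePoints H →
          ∀ μ₀ : ProbabilityMeasure X, (NeymanPearson.level H α μ₀).Nonempty →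
            ∀ n : ℕ, 2 * d ≤ n →
              -- (a) no maximal element: rate of order `d / n`
              (¬ NeymanPearson.AdmitsMaximal (NeymanPearson.level H α μ₀) →
                ENNReal.ofReal (c * ((d : ℝ) / n)) ≤ NeymanPearson.minimaxRisk H α μ₀ n ∧
                (NeymanPearson.EmpiricallyMeasurable H →
                  NeymanPearson.minimaxRisk H α μ₀ n ≤
                    ENNReal.ofReal (C * ((d : ℝ) / n * Real.log n)))) ∧
              -- (b) a maximal element: the problem is trivial
              (NeymanPearson.AdmitsMaximal (NeymanPearson.level H α μ₀) →
                NeymanPearson.minimaxRisk H α μ₀ n = 0)) := by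
  refine ⟨1 / 64, 10, by norm_num, by norm_num, ?_⟩
  intro X _ _ H hmeas d hd α hα0 hα
  refine ⟨fun hsep => ?_, fun hsep μ₀ hne n hn => ⟨fun hmax => ?_, fun hmax =>
    NeymanPearson.minimaxRisk_eq_zero n hmax⟩⟩
  · have hd1 := hsep.one_le hd
    obtain ⟨m, hm, hmd, hdm, ⟨P⟩⟩ := hsep.exists_pairSystem hd
    obtain ⟨μ₀, hne, hlow⟩ := P.exists_forall_le_minimaxRisk hm hα0 hα
    refine ⟨μ₀, hne, fun n hn => ⟨?_, fun hE => ?_⟩⟩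
    · refine le_trans (ENNReal.ofReal_le_ofReal ?_) (hlow n (by omega))
      have hdm' : (d : ℝ) ≤ 6 * m := by exact_mod_cast hdm
      -- From d ≤ 6m ≤ 25m; the factor 5 turns 5/64 into 1/64.
      have : √((d : ℝ) / n) ≤ 5 * √((m : ℝ) / n) := by
        apply Real.sqrt_le_iff.2 ⟨by positivity, ?_⟩
        rw [mul_pow, Real.sq_sqrt (by positivity), ← mul_div_assoc]
        gcongr
        have : (0 : ℝ) ≤ m := by positivity
        linarith
      linarith
    · refine (NeymanPearson.minimaxRisk_le_sqrt hmeas hd hd1 hE hne (by omega)).trans ?_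
      gcongr
      norm_num
  · have hchain := NeymanPearson.level_nested hsep hα (μ₀ := μ₀)
    -- If d = 0, no two members of H differ at a point, so any member would be maximal. With d ≥ 1,
    -- the assumption on n gives n ≥ 2 and log n > 0.
    have hd1 : 1 ≤ d := by
      by_contra hd0
      obtain ⟨h, hh⟩ := hne
      refine hmax ⟨h, hh, fun h' hh' x hx => ?_⟩
      by_contra hx'
      exact hd0 (hd.one_le hh'.1 hh.1 hx (by simpa using hx'))
    refine ⟨?_, fun hE => ?_⟩
    · refine le_trans (ENNReal.ofReal_le_ofReal ?_)
        (NeymanPearson.inv_le_minimaxRisk hchain hmax hne (by omega : 0 < n))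
      -- As d ≤ 2, the rate 1/n already has order d/n.
      have hd2 : (d : ℝ) ≤ 2 := by exact_mod_cast hd.le_two hsep
      have hn' : (0 : ℝ) < n := by exact_mod_cast (by omega : 0 < n)
      rw [one_div_mul_eq_div, div_div, div_le_div_iff₀ (by positivity) (by positivity)]
      nlinarith
    · exact NeymanPearson.minimaxRisk_le_div hmeas hd hd1 hE hne hchain (by omega)
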